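/- All algebras are complex and associative, not necessarily unital. A \emph{separable metrisable locally convex (SMLC) $*$-algebra} is a $*$-algebra with a separable, metrisable, locally convex vector space topology for which multiplication and the star operation are continuous; fix on each a translation invariant metric $d$ defining its topology. Put $a\bullet b=a+b+ab$, $\mathrm{gl}(A)=\{a\in A:\exists a'\in A,\ a\bullet a'=a'\bullet a=0\}$ and $\mathcal U(A)=\{u\in A: u\bullet u^*=u^*\bullet u=0\}$ with the subspace topology, and let $[X,Y]$ be the set of homotopy classes of continuous maps $X\to Y$. $A$ has the \emph{inverse square root property} if, with $A_{sad}=\{a\in A:a^*=a\}$, there are a convex set $V_A\subset A_{sad}$ that contains $0$ and is open in $A_{sad}$, and a continuous $\vartheta_A:V_A\to A_{sad}$ such that $\vartheta_A(0)=0$ and, for all $a\in V_A$: $a\in\mathrm{gl}(A)$, $a\bullet\vartheta_A(a)=\vartheta_A(a)\bullet a$ and $a\bullet(\vartheta_A(a)\bullet\vartheta_A(a))=0$. A \emph{PBAM} (pointwise bounded asymptotic morphism) from $A$ to $B$ is a continuous map $f:A\times[0,\infty)\to B$, $(a,t)\mapsto f_t(a)$, such that: $\{f_t(a):t\ge0\}$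 is bounded in $B$ for each $a$; for all $\epsilon>0$ and $x\in A$ there are $\eta>0$ and $P\ge0$ with $d(f_t(x),f_t(x'))<\epsilon$ whenever $d(x,x')<\eta$ and $t\ge P$; and, as $t\to\infty$, $f_t(a)^*-f_t(a^*)$, $\lambda f_t(a)-f_t(\lambda a)$, $f_t(a)+f_t(a')-f_t(a+a')$ and $f_t(a)f_t(a')-f_t(aa')$ tend to $0$ for all $a,a'\in A$, $\lambda\in\mathbb C$. \emph{Induced class.} Let $f$ be a PBAM from $A$ to $B$, where $B$ has the inverse square root property, with $V_B,\vartheta_B$ chosen. Call a continuous $\alpha:\mathcal U(A)\to[0,\infty)$ admissible if $f_t(v)\bullet f_t(v)^*\in V_B$ and $f_t(v)^*\bullet f_t(v)\in V_B$ for all $v\in\mathcal U(A)$ and $t\ge\alpha(v)$. To say that $\mathcal U(f)$ is a class $c\in[\mathcal U(A),\mathcal U(B)]$ means that admissible $\alpha$ exist and that, for every admissible $\alpha$, the formula $\tilde f_\alpha(v)=f_{\alpha(v)}(v)\bullet\vartheta_B\big(f_{\alpha(v)}(v)^*\bullet f_{\alpha(v)}(v)\big)$ defines a continuous map $\mathcal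 U(A)\to\mathcal U(B)$ whose homotopy class is $c$. \emph{Composition.} Let $f$ and $g$ be PBAMs from $A$ to $B$ and from $B$ to $C$. For a continuous non-decreasing $\phi:[0,\infty)\to[0,\infty)$ put $(g\circ_\phi f)_t(a)=g_{\phi(t)}(f_t(a))$. Then $\phi$ is a \emph{valid reparameterisation} for $f$ and $g$ if $g\circ_\phi f$ is a PBAM and, for every continuous non-decreasing $\theta\ge\phi$, $g\circ_\theta f$ is a PBAM and $h_t(a)(p)=g_{p\phi(t)+(1-p)\theta(t)}(f_t(a))$ defines a PBAM $h$ from $A$ to $C([0,1],C)$ (pointwise operations, supremum metric); such an $h$ is a PBA homotopy between $g\circ_\theta f$ and $g\circ_\phi f$. The pair $f,g$ satisfies C1) if for all $a\in A$ and $\nu>0$ there are $\xi>0$ and $Q'\ge0$ such that for each $t\ge Q'$ there is $S'\ge0$ such that, for all $b\in B$ and $s\ge S'$, $d(f_t(a),b)<\xi$ implies $d(g_s(f_t(a)),g_s(b))<\nu$; C3) if for all $a\in A$ and every continuous seminorm $|\cdot|$ on $C$ there are $Q,M\ge0$ such that for each $t\ge Q$ there is $S\ge0$ with $|g_s(f_t(a))|\le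 M$ for all $s\ge S$. \textbf{Theorem.} Let $A,B,C$ be SMLC $*$-algebras, where $B$ and $C$ have the inverse square root property, with any choice of $(V_B,\vartheta_B)$ and $(V_C,\vartheta_C)$. Let $f$ (from $A$ to $B$) and $g$ (from $B$ to $C$) be PBAMs that satisfy C1 and C3. Then a valid reparameterisation for $f$ and $g$ exists, the classes $\mathcal U(f)\in[\mathcal U(A),\mathcal U(B)]$ and $\mathcal U(g)\in[\mathcal U(B),\mathcal U(C)]$ exist, and for every valid reparameterisation $\phi$ the class $\mathcal U(g\circ_\phi f)$ exists and $$\mathcal U(g\circ_\phi f)=\mathcal U(g)\circ\mathcal U(f)\in[\mathcal U(A),\mathcal U(C)].$$ -/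

import Mathlib

open Filter Topology
open scoped NNReal unitInterval

/-- A separable metrisable locally convex (SMLC) *-algebra: a complex, associative, not necessarily
unital *-algebra with jointly continuous operations and continuous star, whose topology is given by
continuous seminorms, is separable, and is that of a chosen translation invariant metric. -/
class SMLCStarAlgebra (A : Type*) [NonUnitalRing A] [StarRing A] [Module ℂ A] [MetricSpace A] : Prop
    extends IsScalarTower ℂ A A, SMulCommClass ℂ A A, StarModule ℂ A,
      IsTopologicalRing A, ContinuousSMul ℂ A, ContinuousStar A,
      PolynormableSpace ℂ A, TopologicalSpace.SeparableSpace A where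
  dist_add_right_eq : ∀ a b c : A, dist (a + c) (b + c) = dist a b

/-! ## Quasi-multiplication and quasi-unitaries -/

/-- The operation `a • b = a + b + a b`. -/
def qmul {A : Type*} [NonUnitalRing A] (a b : A) : A := a + b + a * b

infixl:70 " ⊙ " => qmul

/-- The quasi-invertible elements `gl(A)`. -/
def quasiGL (A : Type*) [NonUnitalRing A] : Set A :=
  {a | ∃ b : A, a ⊙ b = 0 ∧ b ⊙ a = 0}

/-- The quasi-unitaries `𝒰(A)`; as a type this carries the subspace topology. -/
def quasiUnitary (A : Type*) [NonUnitalRing A] [StarRing A] : Set A :=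
  {u | u ⊙ star u = 0 ∧ star u ⊙ u = 0}

/-- A choice of `V_A` and `ϑ` witnessing the inverse square root property of `A`. Only the values
of `ϑ` on `V` matter. -/
structure InvSqrtData (A : Type*) [NonUnitalRing A] [StarRing A] [Module ℂ A]
    [TopologicalSpace A] where
  /-- the convex open neighbourhood `V_A` of `0` in the self adjoint elements -/
  V : Set A
  /-- the inverse square root function -/
  ϑ : A → A
  V_subset : V ⊆ {a | star a = a}
  V_open : IsOpen (Subtype.val ⁻¹' V : Set {a : A // star a = a})
  V_convex : Convex ℝ V
  zero_mem : (0 : A) ∈ V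
  ϑ_star : ∀ a ∈ V, star (ϑ a) = ϑ a
  ϑ_continuousOn : ContinuousOn ϑ V
  ϑ_comm : ∀ a ∈ V, a ⊙ ϑ a = ϑ a ⊙ a
  ϑ_sq : ∀ a ∈ V, a ⊙ (ϑ a ⊙ ϑ a) = 0
  V_inv : ∀ a ∈ V, a ∈ quasiGL A
  ϑ_zero : ϑ 0 = 0

/-! ## Pointwise bounded asymptotic morphisms

A map `f : A × [0,∞) → B` is written as a family `f t a`, with `t : ℝ≥0`. -/

/-- Strong asymptotic continuity. -/
def StronglyAsymptoticallyContinuous {X Y : Type*} [MetricSpace X] [MetricSpace Y]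
    (F : ℝ≥0 → X → Y) : Prop :=
  ∀ ε > 0, ∀ x : X, ∃ η > 0, ∃ P : ℝ≥0, ∀ x' : X, dist x x' < η →
    ∀ t ≥ P, dist (F t x) (F t x') < ε

/-- Pointwise bounded asymptotic morphisms. -/
structure IsPBAM {A B : Type*}
    [NonUnitalRing A] [StarRing A] [Module ℂ A] [MetricSpace A]
    [NonUnitalRing B] [StarRing B] [Module ℂ B] [MetricSpace B]
    (f : ℝ≥0 → A → B) : Prop where
  continuous : Continuous fun x : A × ℝ≥0 => f x.2 x.1
  bounded : ∀ a, Bornology.IsVonNBounded ℂ (Set.range fun t => f t a)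
  sac : StronglyAsymptoticallyContinuous f
  star_tendsto : ∀ a, Tendsto (fun t => star (f t a) - f t (star a)) atTop (𝓝 0)
  smul_tendsto : ∀ (a : A) (c : ℂ), Tendsto (fun t => c • f t a - f t (c • a)) atTop (𝓝 0)
  add_tendsto : ∀ a a', Tendsto (fun t => f t a + f t a' - f t (a + a')) atTop (𝓝 0)
  mul_tendsto : ∀ a a', Tendsto (fun t => f t a * f t a' - f t (a * a')) atTop (𝓝 0)

/-- `h : A × [0,∞) → C([0,1], B)` is a PBA homotopy from `f` to `g`. Here `C([0,1], B)` has the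
pointwise operations and the supremum metric. -/
def IsPBAHomotopy {A B : Type*}
    [NonUnitalRing A] [StarRing A] [Module ℂ A] [MetricSpace A]
    [NonUnitalRing B] [StarRing B] [Module ℂ B] [MetricSpace B] [SMLCStarAlgebra B]
    (h : ℝ≥0 → A → C(I, B)) (f g : ℝ≥0 → A → B) : Prop :=
  IsPBAM h ∧ ∀ t a, h t a 0 = f t a ∧ h t a 1 = g t a

/-! ## Composition -/

/-- `g ∘_φ f`. -/
def pbamComp {A B C : Type*} (g : ℝ≥0 → B → C) (φ : ℝ≥0 → ℝ≥0) (f : ℝ≥0 → A → B) :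
    ℝ≥0 → A → C :=
  fun t a => g (φ t) (f t a)

/-- `φ` is a valid reparameterisation for `f` and `g`. -/
structure IsValidReparam {A B C : Type*}
    [NonUnitalRing A] [StarRing A] [Module ℂ A] [MetricSpace A]
    [NonUnitalRing C] [StarRing C] [Module ℂ C] [MetricSpace C] [SMLCStarAlgebra C]
    (f : ℝ≥0 → A → B) (g : ℝ≥0 → B → C) (φ : ℝ≥0 → ℝ≥0) : Prop where
  continuous : Continuous φ
  monotone : Monotone φ
  isPBAM : IsPBAM (pbamComp g φ f)
  homotopic : ∀ θ : ℝ≥0 → ℝ≥0, Continuous θ → Monotone θ → (∀ t, φ t ≤ θ t) →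
    IsPBAM (pbamComp g θ f) ∧
    ∃ h : ℝ≥0 → A → C(I, C), IsPBAHomotopy h (pbamComp g θ f) (pbamComp g φ f) ∧
      ∀ t a (p : I), h t a p =
        g (unitInterval.toNNReal p * φ t + unitInterval.toNNReal (unitInterval.symm p) * θ t)
          (f t a)

/-- Condition C1. -/
def ConditionC1 {A B C : Type*} [MetricSpace B] [MetricSpace C]
    (f : ℝ≥0 → A → B) (g : ℝ≥0 → B → C) : Prop :=
  ∀ (a : A), ∀ ν > 0, ∃ ξ > 0, ∃ Q : ℝ≥0, ∀ t ≥ Q, ∃ S : ℝ≥0, ∀ (b : B) (s : ℝ≥0),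
    dist (f t a) b < ξ → S ≤ s → dist (g s (f t a)) (g s b) < ν

/-- Condition C3, with an arbitrary continuous seminorm on `C` (equivalently, every member of any
family of seminorms that defines the topology of `C`). -/
def ConditionC3 {A B C : Type*} [NonUnitalRing C] [Module ℂ C] [TopologicalSpace C]
    (f : ℝ≥0 → A → B) (g : ℝ≥0 → B → C) : Prop :=
  ∀ (a : A) (q : Seminorm ℂ C), Continuous q → ∃ Q M : ℝ≥0, ∀ t ≥ Q, ∃ S : ℝ≥0, ∀ s ≥ S,
    q (g s (f t a)) ≤ M

/-! ## Homotopy classes and the induced class `𝒰(f)` -/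

/-- The set `[X, Y]` of (free) homotopy classes of continuous maps. -/
def HtpyClass (X Y : Type*) [TopologicalSpace X] [TopologicalSpace Y] : Type _ :=
  Quotient (⟨ContinuousMap.Homotopic, ContinuousMap.Homotopic.equivalence⟩ : Setoid C(X, Y))

/-- The homotopy class of a continuous map. -/
def HtpyClass.mk {X Y : Type*} [TopologicalSpace X] [TopologicalSpace Y] (F : C(X, Y)) :
    HtpyClass X Y :=
  Quotient.mk _ F

/-- Composition of homotopy classes. -/
def HtpyClass.comp {X Y Z : Type*} [TopologicalSpace X] [TopologicalSpace Y] [TopologicalSpace Z]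
    (v : HtpyClass Y Z) (u : HtpyClass X Y) : HtpyClass X Z :=
  Quotient.map₂ ContinuousMap.comp (fun _ _ hg _ _ hf => ContinuousMap.Homotopic.comp hg hf) v u

/-- `α` is admissible for `f`: a continuous `α : 𝒰(A) → [0,∞)` such that `f_t(v)` can be corrected
to a quasi-unitary for all `t ≥ α(v)`. -/
def IsAdmissible {A B : Type*}
    [NonUnitalRing A] [StarRing A] [TopologicalSpace A]
    [NonUnitalRing B] [StarRing B] [Module ℂ B] [TopologicalSpace B]
    (D : InvSqrtData B) (f : ℝ≥0 → A → B) (α : quasiUnitary A → ℝ≥0) : Prop :=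
  Continuous α ∧ ∀ v, ∀ t ≥ α v, f t v ⊙ star (f t v) ∈ D.V ∧ star (f t v) ⊙ f t v ∈ D.V

/-- `c` is the class `𝒰(f) ∈ [𝒰(A), 𝒰(B)]`: admissible functions `α` exist, and for every one of
them `v ↦ f_{α(v)}(v) • ϑ(f_{α(v)}(v)^* • f_{α(v)}(v))` is a continuous map `𝒰(A) → 𝒰(B)` of
homotopy class `c`. -/
def IsInducedClass {A B : Type*}
    [NonUnitalRing A] [StarRing A] [TopologicalSpace A]
    [NonUnitalRing B] [StarRing B] [Module ℂ B] [TopologicalSpace B]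
    (D : InvSqrtData B) (f : ℝ≥0 → A → B)
    (c : HtpyClass (quasiUnitary A) (quasiUnitary B)) : Prop :=
  (∃ α, IsAdmissible D f α) ∧
  ∀ α, IsAdmissible D f α → ∃ F : C(quasiUnitary A, quasiUnitary B),
    (∀ v, (F v : B) = f (α v) v ⊙ D.ϑ (star (f (α v) v) ⊙ f (α v) v)) ∧ HtpyClass.mk F = c

/-- There is at most one class `𝒰(f)`. -/
theorem IsInducedClass.unique {A B : Type*}
    [NonUnitalRing A] [StarRing A] [TopologicalSpace A]
    [NonUnitalRing B] [StarRing B] [Module ℂ B] [TopologicalSpace B]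
    {D : InvSqrtData B} {f : ℝ≥0 → A → B}
    {c c' : HtpyClass (quasiUnitary A) (quasiUnitary B)}
    (h : IsInducedClass D f c) (h' : IsInducedClass D f c') : c = c' := by
  obtain ⟨α, hα⟩ := h.1
  obtain ⟨F, hF, rfl⟩ := h.2 α hα
  obtain ⟨F', hF', rfl⟩ := h'.2 α hα
  have : F = F' := ContinuousMap.ext fun v => Subtype.ext ((hF v).trans (hF' v).symm)
  rw [this]

/-! Everything is phrased for asymptotic morphisms along an arbitrary filter. Strong asymptotic
continuity makes each asymptotic identity locally uniform in the algebra variable.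

Existence of a reparameterisation: the family `g s (f t a)` is asymptotic along `iteratedAtTop`, by
C1 and C3 (`isAsymptoticAlong_comp`). As `A` is second countable and `C` is metrisable, countably
many conditions express this, so it holds along a coarser, countably generated filter
(`IsAsymptoticAlong.exists_countablyGenerated`). A diagonal choice puts the region above some graph
`φ` inside that filter (`exists_aboveGraph_le`), which handles every larger reparameterisation at
once.

Induced classes: local thresholds glue to a continuous `α`, and interpolating between two admissible
functions is a homotopy. For a composite with index far above the graph, `f_γ(v)` is joined to its
correction by a path of almost unitaries so close to unitary that `g` at a large index maps them to
correctable elements. Applying `g` along this path, then moving its index, yields the product of the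
two classes (`isInducedClass_comp`). An arbitrary valid reparameterisation is reached by a PBA
homotopy from a larger one. -/

set_option linter.unusedSectionVars false

/-! ### Algebra of the quasi-multiplication. -/

section QuasiMultiplication

variable {A : Type*} [NonUnitalRing A]

theorem qmul_assoc (a b c : A) : a ⊙ b ⊙ c = a ⊙ (b ⊙ c) := by
  simp only [qmul, mul_add, add_mul, mul_assoc]
  abel

@[simp] theorem zero_qmul (a : A) : 0 ⊙ a = a := by simp [qmul]

@[simp] theorem qmul_zero (a : A) : a ⊙ 0 = a := by simp [qmul]

theorem star_qmul [StarRing A] (a b : A) : star (a ⊙ b) = star b ⊙ star a := by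
  simp only [qmul, star_add, star_mul]
  abel

/-- A left and a right quasi-inverse coincide. -/
theorem eq_of_qmul_eq_zero {x l r : A} (hl : l ⊙ x = 0) (hr : x ⊙ r = 0) : l = r := by
  rw [← qmul_zero l, ← hr, ← qmul_assoc, hl, zero_qmul]

theorem Continuous.qmul {X : Type*} [TopologicalSpace X] [TopologicalSpace A]
    [IsTopologicalRing A] {u v : X → A} (hu : Continuous u) (hv : Continuous v) :
    Continuous fun x => u x ⊙ v x := by
  unfold _root_.qmul
  fun_prop

theorem Filter.Tendsto.qmul_zero {T : Type*} {L : Filter T} [TopologicalSpace A]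
    [IsTopologicalRing A] {u v : T → A} (hu : Tendsto u L (𝓝 0)) (hv : Tendsto v L (𝓝 0)) :
    Tendsto (fun x => u x ⊙ v x) L (𝓝 0) := by
  simpa [qmul] using (hu.add hv).add (hu.mul hv)

end QuasiMultiplication

/-! ### Correction to quasi-unitaries. -/

section NearUnitary

variable {B : Type*} [NonUnitalRing B] [StarRing B] [Module ℂ B] [TopologicalSpace B]

/-- The elements that can be corrected to a quasi-unitary with the help of `ϑ`. -/
def nearUnitary (D : InvSqrtData B) : Set B := {x | x ⊙ star x ∈ D.V ∧ star x ⊙ x ∈ D.V}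

/-- With `z = ϑ(x^* • x)`, the element `z • z • x^*` is a left quasi-inverse of `x`.
Quasi-invertibility of `x • x^*` supplies a right one, so the two agree and the left inverse is
two-sided; this is where both conditions in `nearUnitary` enter. -/
theorem qmul_invSqrt_mem_quasiUnitary (D : InvSqrtData B) {x : B} (hx : x ∈ nearUnitary D) :
    x ⊙ D.ϑ (star x ⊙ x) ∈ quasiUnitary B := by
  obtain ⟨h1, h2⟩ := hx
  set y := star x ⊙ x with hy
  have hz := D.ϑ_star y h2
  have hc := D.ϑ_comm y h2
  have hs := D.ϑ_sq y h2
  set z := D.ϑ y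
  have hs' : z ⊙ z ⊙ y = 0 := by
    rw [qmul_assoc, ← hc, ← qmul_assoc, ← hc, qmul_assoc, hs]
  have hl : (z ⊙ z ⊙ star x) ⊙ x = 0 := by rw [qmul_assoc, ← hy, hs']
  obtain ⟨w, hw, -⟩ := D.V_inv _ h1
  have hr : x ⊙ (star x ⊙ w) = 0 := by rw [← qmul_assoc, hw]
  have hxl : x ⊙ (z ⊙ z ⊙ star x) = 0 := by rw [eq_of_qmul_eq_zero hl hr, hr]
  constructor
  · rw [star_qmul, hz, qmul_assoc, ← qmul_assoc z z, hxl]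
  · rw [star_qmul, hz, qmul_assoc, ← qmul_assoc (star x), ← hy, hc, ← qmul_assoc, hs']

/-- The correction map `x ↦ x • ϑ(x^* • x)` onto the quasi-unitaries. -/
def unitarize [IsTopologicalRing B] [ContinuousStar B] (D : InvSqrtData B) :
    C(nearUnitary D, quasiUnitary B) where
  toFun x := ⟨x ⊙ D.ϑ (star (x : B) ⊙ x), qmul_invSqrt_mem_quasiUnitary D x.2⟩
  continuous_toFun := by
    refine Continuous.subtype_mk (Continuous.qmul continuous_subtype_val ?_) _
    refine D.ϑ_continuousOn.comp_continuous ?_ fun x => x.2.2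
    exact Continuous.qmul (continuous_subtype_val.star) continuous_subtype_val

theorem InvSqrtData.exists_nhds_subset (D : InvSqrtData B) :
    ∃ W ∈ 𝓝 (0 : B), ∀ x ∈ W, star x = x → x ∈ D.V := by
  have h : (Subtype.val ⁻¹' D.V : Set {a : B // star a = a}) ∈ 𝓝 ⟨0, star_zero B⟩ :=
    D.V_open.mem_nhds D.zero_mem
  rw [nhds_subtype_eq_comap, mem_comap] at h
  obtain ⟨W, hW, hsub⟩ := h
  exact ⟨W, hW, fun x hx hs => @hsub ⟨x, hs⟩ hx⟩

theorem InvSqrtData.tendsto_invSqrt (D : InvSqrtData B) {T : Type*} {L : Filter T} {y : T → B}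
    (hy : Tendsto y L (𝓝 0)) (hV : ∀ᶠ t in L, y t ∈ D.V) :
    Tendsto (fun t => D.ϑ (y t)) L (𝓝 0) := by
  have h := D.ϑ_continuousOn 0 D.zero_mem
  rw [ContinuousWithinAt, D.ϑ_zero] at h
  exact h.comp (tendsto_nhdsWithin_iff.2 ⟨hy, hV⟩)

end NearUnitary

/-! ### Boundedness along a filter. -/

section BoundedAlong

variable {T B : Type*} [NonUnitalRing B] [Module ℂ B] [TopologicalSpace B]

/-- `u` is bounded along the filter `L`: scaling by a null family of scalars makes it null. -/
def BoundedAlong (L : Filter T) (u : T → B) : Prop :=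
  Tendsto (fun p : ℂ × T => p.1 • u p.2) (𝓝 0 ×ˢ L) (𝓝 0)

variable {L : Filter T} {u v : T → B}

theorem BoundedAlong.comp {S : Type*} {K : Filter S} (hu : BoundedAlong L u) {k : S → T}
    (hk : Tendsto k K L) : BoundedAlong K fun s => u (k s) :=
  Tendsto.comp hu (tendsto_id.prodMap hk)

theorem BoundedAlong.star [StarRing B] [StarModule ℂ B] [ContinuousStar B]
    (hu : BoundedAlong L u) : BoundedAlong L fun t => star (u t) := by
  have h1 : Tendsto (fun c : ℂ => Star.star c) (𝓝 0) (𝓝 0) := by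
    simpa using (continuous_star (R := ℂ)).tendsto 0
  have h := (continuous_star.tendsto (0 : B)).comp (Tendsto.comp hu (h1.prodMap tendsto_id))
  simpa [BoundedAlong, Function.comp_def] using h

theorem BoundedAlong.add_null [ContinuousAdd B] [ContinuousSMul ℂ B] (hu : BoundedAlong L u)
    (hv : Tendsto v L (𝓝 0)) : BoundedAlong L fun t => u t + v t := by
  have h : Tendsto (fun p : ℂ × T => p.1 • v p.2) (𝓝 0 ×ˢ L) (𝓝 0) := by
    simpa using (tendsto_fst (f := 𝓝 (0 : ℂ)) (g := L)).smul (hv.comp tendsto_snd)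
  simpa [BoundedAlong, smul_add] using Tendsto.add hu h

theorem BoundedAlong.exists_ne_zero (hu : BoundedAlong L u) {W : Set B} (hW : W ∈ 𝓝 (0 : B)) :
    ∃ c : ℂ, c ≠ 0 ∧ ∀ᶠ t in L, c • u t ∈ W := by
  have h : ∀ᶠ c in 𝓝 (0 : ℂ), ∀ᶠ t in L, c • u t ∈ W := (hu.eventually hW).curry
  obtain ⟨c, hc, hne⟩ := ((h.filter_mono nhdsWithin_le_nhds).and
    (self_mem_nhdsWithin : _ ∈ 𝓝[≠] (0 : ℂ))).exists
  exact ⟨c, hne, hc⟩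

/-- For one fixed `c ≠ 0` the bounded factor, scaled by `c`, is eventually in a given neighbourhood
of `0`; then `u v = (c⁻¹ u)(c v)` and joint continuity at `0` suffices. -/
theorem tendsto_null_mul_bounded [IsScalarTower ℂ B B] [SMulCommClass ℂ B B] [ContinuousMul B]
    [ContinuousSMul ℂ B] (hu : Tendsto u L (𝓝 0)) (hv : BoundedAlong L v) :
    Tendsto (fun t => u t * v t) L (𝓝 0) := by
  intro W hW
  have hm : Tendsto (fun p : B × B => p.1 * p.2) (𝓝 0 ×ˢ 𝓝 0) (𝓝 0) := by
    simpa [nhds_prod_eq] using (continuous_mul (M := B)).tendsto (0, 0)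
  obtain ⟨U, hU, U', hU', h⟩ := mem_prod_iff.1 (hm hW)
  obtain ⟨c, hc, hcv⟩ := hv.exists_ne_zero hU'
  have hcu : Tendsto (fun t => c⁻¹ • u t) L (𝓝 0) := by simpa using hu.const_smul c⁻¹
  rw [mem_map]
  filter_upwards [hcv, hcu.eventually_mem hU] with t h1 h2
  have := @h (c⁻¹ • u t, c • v t) ⟨h2, h1⟩
  simpa [smul_mul_smul_comm, hc] using this

theorem tendsto_bounded_mul_null [IsScalarTower ℂ B B] [SMulCommClass ℂ B B] [ContinuousMul B]
    [ContinuousSMul ℂ B] (hu : BoundedAlong L u) (hv : Tendsto v L (𝓝 0)) :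
    Tendsto (fun t => u t * v t) L (𝓝 0) := by
  intro W hW
  have hm : Tendsto (fun p : B × B => p.1 * p.2) (𝓝 0 ×ˢ 𝓝 0) (𝓝 0) := by
    simpa [nhds_prod_eq] using (continuous_mul (M := B)).tendsto (0, 0)
  obtain ⟨U, hU, U', hU', h⟩ := mem_prod_iff.1 (hm hW)
  obtain ⟨c, hc, hcu⟩ := hu.exists_ne_zero hU
  have hcv : Tendsto (fun t => c⁻¹ • v t) L (𝓝 0) := by simpa using hv.const_smul c⁻¹
  rw [mem_map]
  filter_upwards [hcu, hcv.eventually_mem hU'] with t h1 h2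
  have := @h (c • u t, c⁻¹ • v t) ⟨h1, h2⟩
  simpa [smul_mul_smul_comm, hc] using this

/-- Balanced neighbourhoods absorb the scalar. The factor `⊤` on `I` encodes uniformity in the path
parameter, here and below. -/
theorem tendsto_unitInterval_smul_null [ContinuousSMul ℂ B] (hu : Tendsto u L (𝓝 0)) :
    Tendsto (fun p : T × I => (p.2 : ℝ) • u p.1) (L ×ˢ ⊤) (𝓝 0) := by
  refine (nhds_basis_balanced ℂ B).tendsto_right_iff.2 fun W ⟨hW, hbal⟩ => ?_
  filter_upwards [tendsto_fst.eventually (hu.eventually_mem hW)] with p hp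
  have h := hbal.smul_mem (a := ((p.2 : ℝ) : ℂ)) (by
    rw [Complex.norm_real, Real.norm_of_nonneg p.2.2.1]; exact p.2.2.2) hp
  simpa using h

theorem boundedAlong_of_isVonNBounded [ContinuousSMul ℂ B]
    (h : Bornology.IsVonNBounded ℂ (Set.range u)) : BoundedAlong L u := by
  intro W hW
  obtain ⟨r, hr, hW'⟩ := (absorbs_iff_eventually_nhds_zero
    (mem_of_mem_nhds hW)).1 (h hW) |>.exists_mem
  rw [mem_map]
  refine mem_of_superset (prod_mem_prod hr univ_mem) fun p hp => ?_
  exact hW' p.1 hp.1 ⟨p.2, rfl⟩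

theorem boundedAlong_of_seminorm [IsTopologicalAddGroup B] [PolynormableSpace ℂ B]
    (h : ∀ q : Seminorm ℂ B, Continuous q → ∃ M : ℝ, ∀ᶠ t in L, q (u t) ≤ M) :
    BoundedAlong L u := by
  refine ((PolynormableSpace.withSeminorms ℂ B).tendsto_nhds _ 0).2 fun q ε hε => ?_
  obtain ⟨M, hM⟩ := h q.1 q.2
  have h1 : Tendsto (fun p : ℂ × T => ‖p.1‖ * |M|) (𝓝 0 ×ˢ L) (𝓝 0) := by
    have := (tendsto_fst (f := 𝓝 (0 : ℂ)) (g := L)).norm.mul_const |M|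
    simpa using this
  filter_upwards [h1.eventually (gt_mem_nhds hε), tendsto_snd.eventually hM] with p hp hp'
  rw [sub_zero]
  change q.1 (p.1 • u p.2) < ε
  rw [map_smul_eq_mul]
  exact lt_of_le_of_lt (mul_le_mul_of_nonneg_left (hp'.trans (le_abs_self M)) (norm_nonneg _)) hp

end BoundedAlong

/-! ### Asymptotic morphisms along a filter and locally uniform identities. -/

/-- Asymptotic morphisms along a filter `L` on the index set, with no continuity in the index. -/
structure IsAsymptoticAlong {T A B : Type*}
    [NonUnitalRing A] [StarRing A] [Module ℂ A] [TopologicalSpace A]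
    [NonUnitalRing B] [StarRing B] [Module ℂ B] [TopologicalSpace B]
    (L : Filter T) (F : T → A → B) : Prop where
  bounded : ∀ a, BoundedAlong L fun t => F t a
  sac : ∀ a, Tendsto (fun p : A × T => F p.2 p.1 - F p.2 a) (𝓝 a ×ˢ L) (𝓝 0)
  star : ∀ a, Tendsto (fun t => star (F t a) - F t (star a)) L (𝓝 0)
  smul : ∀ (c : ℂ) (a : A), Tendsto (fun t => c • F t a - F t (c • a)) L (𝓝 0)
  add : ∀ a b, Tendsto (fun t => F t a + F t b - F t (a + b)) L (𝓝 0)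
  mul : ∀ a b, Tendsto (fun t => F t a * F t b - F t (a * b)) L (𝓝 0)

namespace IsAsymptoticAlong

variable {T S A B : Type*}
  [NonUnitalRing A] [StarRing A] [Module ℂ A] [MetricSpace A] [SMLCStarAlgebra A]
  [NonUnitalRing B] [StarRing B] [Module ℂ B] [MetricSpace B] [SMLCStarAlgebra B]
  {L : Filter T} {K : Filter S} {F : T → A → B}

theorem comp_tendsto (hF : IsAsymptoticAlong L F) {k : S → T} (hk : Tendsto k K L) :
    IsAsymptoticAlong K fun s => F (k s) where
  bounded a := (hF.bounded a).comp hk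
  sac a := (hF.sac a).comp (tendsto_id.prodMap hk)
  star a := (hF.star a).comp hk
  smul c a := (hF.smul c a).comp hk
  add a b := (hF.add a b).comp hk
  mul a b := (hF.mul a b).comp hk

theorem sac_comp (hF : IsAsymptoticAlong L F) {X : Type*} {M : Filter X} {u : X → A} {a : A}
    (hu : Tendsto u M (𝓝 a)) :
    Tendsto (fun p : X × T => F p.2 (u p.1) - F p.2 a) (M ×ˢ L) (𝓝 0) :=
  (hF.sac a).comp (hu.prodMap tendsto_id)

theorem bounded_nhds (hF : IsAsymptoticAlong L F) (a : A) :
    BoundedAlong (𝓝 a ×ˢ L) fun p : A × T => F p.2 p.1 := by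
  have h := ((hF.bounded a).comp (tendsto_snd (f := 𝓝 a) (g := L))).add_null (hF.sac a)
  simpa using h

/-- Here and in the next lemmas, `sac` at each point involved upgrades a pointwise identity to one
near that point. The local form is what allows Lindelöf arguments and moving points such as `f t a`.
-/
theorem star_nhds (hF : IsAsymptoticAlong L F) (a : A) :
    Tendsto (fun p : A × T => Star.star (F p.2 p.1) - F p.2 (Star.star p.1)) (𝓝 a ×ˢ L)
      (𝓝 0) := by
  have h1 := (continuous_star.tendsto (0 : B)).comp (hF.sac a)
  have h2 := (hF.star a).comp (tendsto_snd (f := 𝓝 a) (g := L))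
  have h3 := hF.sac_comp ((continuous_star (R := A)).tendsto a)
  have h := (h1.add h2).sub h3
  simp only [star_zero, add_zero, sub_zero] at h
  refine h.congr fun p => ?_
  simp only [Function.comp_apply, star_sub]
  abel

theorem smul_nhds (hF : IsAsymptoticAlong L F) (x : ℂ × A) :
    Tendsto (fun p : (ℂ × A) × T => p.1.1 • F p.2 p.1.2 - F p.2 (p.1.1 • p.1.2)) (𝓝 x ×ˢ L)
      (𝓝 0) := by
  have hc : Tendsto (fun p : (ℂ × A) × T => p.1.1) (𝓝 x ×ˢ L) (𝓝 x.1) :=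
    (continuous_fst.tendsto x).comp tendsto_fst
  have h1 := hc.smul ((hF.sac_comp (continuous_snd.tendsto x)))
  have h2 : Tendsto (fun p : (ℂ × A) × T => (p.1.1 - x.1) • F p.2 x.2) (𝓝 x ×ˢ L) (𝓝 0) := by
    have hc0 : Tendsto (fun p : (ℂ × A) × T => p.1.1 - x.1) (𝓝 x ×ˢ L) (𝓝 0) := by
      simpa using hc.sub_const x.1
    exact Tendsto.comp (hF.bounded x.2) (hc0.prodMk tendsto_snd)
  have h3 := (hF.smul x.1 x.2).comp (tendsto_snd (f := 𝓝 x) (g := L))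
  have h4 := hF.sac_comp ((continuous_smul (M := ℂ) (X := A)).tendsto x)
  have h := ((h1.add h2).add h3).sub h4
  simp only [smul_zero, add_zero, sub_zero] at h
  refine h.congr fun p => ?_
  simp only [Function.comp_apply, smul_sub, sub_smul]
  abel

theorem add_nhds (hF : IsAsymptoticAlong L F) (x : A × A) :
    Tendsto (fun p : (A × A) × T => F p.2 p.1.1 + F p.2 p.1.2 - F p.2 (p.1.1 + p.1.2)) (𝓝 x ×ˢ L)
      (𝓝 0) := by
  have h1 := hF.sac_comp (continuous_fst.tendsto x)
  have h2 := hF.sac_comp (continuous_snd.tendsto x)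
  have h3 := (hF.add x.1 x.2).comp (tendsto_snd (f := 𝓝 x) (g := L))
  have h4 := hF.sac_comp ((continuous_add (M := A)).tendsto x)
  have h := ((h1.add h2).add h3).sub h4
  simp only [add_zero, sub_zero] at h
  refine h.congr fun p => ?_
  simp only [Function.comp_apply]
  abel

theorem mul_nhds (hF : IsAsymptoticAlong L F) (x : A × A) :
    Tendsto (fun p : (A × A) × T => F p.2 p.1.1 * F p.2 p.1.2 - F p.2 (p.1.1 * p.1.2)) (𝓝 x ×ˢ L)
      (𝓝 0) := by
  have hfst : Tendsto (fun p : (A × A) × T => (p.1.1, p.2)) (𝓝 x ×ˢ L) (𝓝 x.1 ×ˢ L) :=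
    (continuous_fst.tendsto x).prodMap tendsto_id
  have h1 := tendsto_bounded_mul_null ((hF.bounded_nhds x.1).comp hfst)
    (hF.sac_comp (continuous_snd.tendsto x))
  have h2 := tendsto_null_mul_bounded (hF.sac_comp (continuous_fst.tendsto x))
    ((hF.bounded x.2).comp (tendsto_snd (f := 𝓝 x) (g := L)))
  have h3 := (hF.mul x.1 x.2).comp (tendsto_snd (f := 𝓝 x) (g := L))
  have h4 := hF.sac_comp ((continuous_mul (M := A)).tendsto x)
  have h := ((h1.add h2).add h3).sub h4
  simp only [add_zero, sub_zero] at h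
  refine h.congr fun p => ?_
  simp only [Function.comp_apply, mul_sub, sub_mul]
  abel

/-- Asymptotic homogeneity with scalar `0` gives `F t 0 → 0`; `sac` does the rest. -/
theorem tendsto_zero (hF : IsAsymptoticAlong L F) :
    Tendsto (fun p : A × T => F p.2 p.1) (𝓝 0 ×ˢ L) (𝓝 0) := by
  have h1 := (hF.smul 0 0).comp (tendsto_snd (f := 𝓝 (0 : A)) (g := L))
  simpa [Function.comp_def] using (hF.sac 0).sub h1

theorem qmul_nhds (hF : IsAsymptoticAlong L F) (x : A × A) :
    Tendsto (fun p : (A × A) × T => F p.2 p.1.1 ⊙ F p.2 p.1.2 - F p.2 (p.1.1 ⊙ p.1.2)) (𝓝 x ×ˢ L)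
      (𝓝 0) := by
  have hk : Tendsto (fun y : A × A => (y.1 + y.2, y.1 * y.2)) (𝓝 x)
      (𝓝 (x.1 + x.2, x.1 * x.2)) :=
    (continuous_add.prodMk continuous_mul).tendsto x
  have h1 := (hF.add_nhds _).comp (hk.prodMap (tendsto_id (x := L)))
  have h := ((hF.add_nhds x).add (hF.mul_nhds x)).add h1
  simp only [add_zero] at h
  refine h.congr fun p => ?_
  simp only [Function.comp_apply, Prod.map, qmul, id]
  abel

theorem qmul_star_nhds (hF : IsAsymptoticAlong L F) (a : A) :
    Tendsto (fun p : A × T => F p.2 p.1 ⊙ Star.star (F p.2 p.1) - F p.2 (p.1 ⊙ Star.star p.1))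
      (𝓝 a ×ˢ L) (𝓝 0) := by
  have hk : Tendsto (fun y : A => (y, Star.star y)) (𝓝 a) (𝓝 (a, Star.star a)) :=
    (continuous_id.prodMk continuous_star).tendsto a
  have h1 := (hF.qmul_nhds _).comp (hk.prodMap (tendsto_id (x := L)))
  have h := ((hF.star_nhds a).add
    (tendsto_bounded_mul_null (hF.bounded_nhds a) (hF.star_nhds a))).add h1
  simp only [add_zero] at h
  refine h.congr fun p => ?_
  simp only [Function.comp_apply, Prod.map, qmul, id, mul_sub]
  abel

theorem star_qmul_nhds (hF : IsAsymptoticAlong L F) (a : A) :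
    Tendsto (fun p : A × T => Star.star (F p.2 p.1) ⊙ F p.2 p.1 - F p.2 (Star.star p.1 ⊙ p.1))
      (𝓝 a ×ˢ L) (𝓝 0) := by
  have hk : Tendsto (fun y : A => (Star.star y, y)) (𝓝 a) (𝓝 (Star.star a, a)) :=
    (continuous_star.prodMk continuous_id).tendsto a
  have h1 := (hF.qmul_nhds _).comp (hk.prodMap (tendsto_id (x := L)))
  have h := ((hF.star_nhds a).add
    (tendsto_null_mul_bounded (hF.star_nhds a) (hF.bounded_nhds a))).add h1
  simp only [add_zero] at h
  refine h.congr fun p => ?_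
  simp only [Function.comp_apply, Prod.map, qmul, id, sub_mul]
  abel

end IsAsymptoticAlong

/-! ### Almost unitary elements and their images. -/

/-- The elements `w` such that `w • w^*` and `w^* • w` lie in `O`. -/
def almostUnitary {A : Type*} [NonUnitalRing A] [StarRing A] (O : Set A) : Set A :=
  {w | w ⊙ star w ∈ O ∧ star w ⊙ w ∈ O}

theorem quasiUnitary_subset_almostUnitary {A : Type*} [NonUnitalRing A] [StarRing A] {O : Set A}
    (hO : (0 : A) ∈ O) : quasiUnitary A ⊆ almostUnitary O := fun u hu => by
  rw [almostUnitary, Set.mem_ofPred_eq, hu.1, hu.2]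
  exact ⟨hO, hO⟩

section AlmostUnitary

variable {T A B : Type*}
  [NonUnitalRing A] [StarRing A] [Module ℂ A] [MetricSpace A] [SMLCStarAlgebra A]
  [NonUnitalRing B] [StarRing B] [Module ℂ B] [MetricSpace B] [SMLCStarAlgebra B]
  {L : Filter T} {F : T → A → B}

theorem isOpen_almostUnitary {O : Set A} (hO : IsOpen O) : IsOpen (almostUnitary O) :=
  (hO.preimage (Continuous.qmul continuous_id continuous_star)).inter
    (hO.preimage (Continuous.qmul continuous_star continuous_id))

/-- `F(w) • F(w)^*` is asymptotically `F(w • w^*)`, which is small once `w • w^*` is in a small `O`,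
by `tendsto_zero`. The sum of the two errors is self-adjoint and near `0`, hence in `V`. It matters
that `O` does not depend on `w`. -/
theorem IsAsymptoticAlong.exists_isOpen_eventually_mem_nearUnitary (hF : IsAsymptoticAlong L F)
    (D : InvSqrtData B) :
    ∃ O : Set A, IsOpen O ∧ (0 : A) ∈ O ∧
      ∀ w ∈ almostUnitary O, ∀ᶠ p : A × T in 𝓝 w ×ˢ L, F p.2 p.1 ∈ nearUnitary D := by
  obtain ⟨W, hW, hWD⟩ := D.exists_nhds_subset
  have hadd : Tendsto (fun p : B × B => p.1 + p.2) (𝓝 0 ×ˢ 𝓝 0) (𝓝 0) := by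
    simpa [nhds_prod_eq] using (continuous_add (M := B)).tendsto (0, 0)
  obtain ⟨U, hU, U', hU', hUW⟩ := mem_prod_iff.1 (hadd hW)
  obtain ⟨N, hN, S, hS, hNS⟩ := mem_prod_iff.1 (hF.tendsto_zero hU')
  obtain ⟨O, hON, hO, h0⟩ := mem_nhds_iff.1 hN
  refine ⟨O, hO, h0, fun w hw => ?_⟩
  filter_upwards [(hF.qmul_star_nhds w).eventually_mem hU,
    (hF.star_qmul_nhds w).eventually_mem hU, tendsto_snd.eventually_mem hS,
    tendsto_fst.eventually_mem ((isOpen_almostUnitary hO).mem_nhds hw)] with p h1 h2 h3 h4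
  have key : ∀ x y, x - F p.2 y ∈ U → y ∈ O → Star.star x = x → x ∈ D.V := fun x y hx hy hs => by
    refine hWD _ ?_ hs
    have := @hUW (_, _) ⟨hx, @hNS (y, p.2) ⟨hON hy, h3⟩⟩
    simpa using this
  exact ⟨key _ _ h1 h4.1 (by rw [star_qmul, star_star]),
    key _ _ h2 h4.2 (by rw [star_qmul, star_star])⟩

theorem IsAsymptoticAlong.eventually_mem_nearUnitary (hF : IsAsymptoticAlong L F)
    (D : InvSqrtData B) (v : quasiUnitary A) :
    ∀ᶠ p : quasiUnitary A × T in 𝓝 v ×ˢ L, F p.2 p.1 ∈ nearUnitary D := by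
  obtain ⟨O, -, h0, h⟩ := hF.exists_isOpen_eventually_mem_nearUnitary D
  exact ((continuous_subtype_val.tendsto v).prodMap tendsto_id).eventually
    (h v (quasiUnitary_subset_almostUnitary h0 v.2))

/-- The path `p ↦ x • ϑ(p (x^* • x))` from `x` to its correction. -/
def invSqrtPath (D : InvSqrtData B) (p : I) (x : B) : B := x ⊙ D.ϑ ((p : ℝ) • (star x ⊙ x))

/-- Put `x = F(v)`, `y = x^* • x` and `k = ϑ(r y)`. Since `y → 0`, also `k → 0` uniformly in `r`.
One product for `x • k` is `k • y • k`; the other is `x • (k • k) • x^*`, which differs from `x •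
x^* → 0` by terms that vanish because `x` is bounded. -/
theorem IsAsymptoticAlong.eventually_invSqrtPath_mem (hF : IsAsymptoticAlong L F)
    (D : InvSqrtData B) {O : Set B} (hO : IsOpen O) (h0 : (0 : B) ∈ O) (v : quasiUnitary A) :
    ∀ᶠ p : quasiUnitary A × T in 𝓝 v ×ˢ L,
      ∀ r : I, invSqrtPath D r (F p.2 p.1) ∈ almostUnitary O := by
  set M : Filter (quasiUnitary A × T) := 𝓝 v ×ˢ L with hM
  have hk : Tendsto (fun p : quasiUnitary A × T => ((p.1 : A), p.2)) M (𝓝 (v : A) ×ˢ L) :=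
    (continuous_subtype_val.tendsto v).prodMap tendsto_id
  have hF0 : Tendsto (fun t => F t 0) L (𝓝 0) := by
    have h : Tendsto (fun t : T => ((0 : A), t)) L (𝓝 0 ×ˢ L) :=
      tendsto_const_nhds.prodMk tendsto_id
    exact hF.tendsto_zero.comp h
  set x : (quasiUnitary A × T) × I → B := fun q => F q.1.2 q.1.1 with hx
  have hxb : BoundedAlong (M ×ˢ ⊤) x := ((hF.bounded_nhds v).comp hk).comp tendsto_fst
  have hy0 : Tendsto (fun p : quasiUnitary A × T => Star.star (F p.2 p.1) ⊙ F p.2 p.1) M (𝓝 0) := by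
    have h := ((hF.star_qmul_nhds v).comp hk).add (hF0.comp tendsto_snd)
    rw [add_zero] at h
    refine h.congr fun p => ?_
    simp [p.1.2.2]
  have hy1 : Tendsto (fun p : quasiUnitary A × T => F p.2 p.1 ⊙ Star.star (F p.2 p.1)) M (𝓝 0) := by
    have h := ((hF.qmul_star_nhds v).comp hk).add (hF0.comp tendsto_snd)
    rw [add_zero] at h
    refine h.congr fun p => ?_
    simp [p.1.2.1]
  have hnear := hF.eventually_mem_nearUnitary D v
  set k : (quasiUnitary A × T) × I → B :=
    fun q => D.ϑ ((q.2 : ℝ) • (Star.star (x q) ⊙ x q)) with hkdef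
  have hV : ∀ᶠ q in M ×ˢ (⊤ : Filter I), (q.2 : ℝ) • (Star.star (x q) ⊙ x q) ∈ D.V := by
    filter_upwards [tendsto_fst.eventually hnear] with q hq
    exact D.V_convex.smul_mem_of_zero_mem D.zero_mem hq.2 q.2.2
  have hk0 : Tendsto k (M ×ˢ ⊤) (𝓝 0) :=
    D.tendsto_invSqrt (tendsto_unitInterval_smul_null hy0) hV
  have hks : ∀ᶠ q in M ×ˢ (⊤ : Filter I), Star.star (k q) = k q := hV.mono fun q hq => D.ϑ_star _ hq
  have hl : Tendsto (fun q => Star.star (x q ⊙ k q) ⊙ (x q ⊙ k q)) (M ×ˢ ⊤) (𝓝 0) := by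
    refine ((hk0.qmul_zero (hy0.comp tendsto_fst)).qmul_zero hk0).congr' ?_
    filter_upwards [hks] with q hq
    simp only [star_qmul, hq, qmul_assoc, Function.comp_apply, hx]
  have hr : Tendsto (fun q => (x q ⊙ k q) ⊙ Star.star (x q ⊙ k q)) (M ×ˢ ⊤) (𝓝 0) := by
    have hkk := hk0.qmul_zero hk0
    have h1 := tendsto_bounded_mul_null hxb hkk
    have h2 := tendsto_null_mul_bounded hkk hxb.star
    have h3 := tendsto_null_mul_bounded h1 hxb.star
    have h := (((hy1.comp tendsto_fst).add hkk).add (h1.add h2)).add h3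
    simp only [add_zero] at h
    refine h.congr' ?_
    filter_upwards [hks] with q hq
    rw [star_qmul, hq, qmul_assoc, ← qmul_assoc (k q)]
    simp only [qmul, mul_add, add_mul, mul_assoc, Function.comp_apply, hx]
    abel
  have h := (hr.eventually_mem (hO.mem_nhds h0)).and (hl.eventually_mem (hO.mem_nhds h0))
  rw [← Filter.principal_univ, eventually_prod_principal_iff] at h
  filter_upwards [h] with p hp r
  exact hp r (Set.mem_univ r)

end AlmostUnitary

/-! ### Continuous thresholds, filters on pairs of indices, diagonalisation. -/

section Thresholds

/-- The good thresholds at a point form an upward closed, hence convex, set of reals, so locally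
constant choices are glued by a partition of unity. -/
theorem exists_continuous_threshold {X : Type*} [TopologicalSpace X] [NormalSpace X]
    [ParacompactSpace X] {P : X → ℝ≥0 → Prop} (h : ∀ x, ∀ᶠ p in 𝓝 x ×ˢ atTop, P p.1 p.2) :
    ∃ α : X → ℝ≥0, Continuous α ∧ ∀ x, ∀ t ≥ α x, P x t := by
  obtain ⟨g, hg⟩ := exists_continuous_forall_mem_convex_of_local_const (E := ℝ)
    (t := fun x => {r : ℝ | 0 ≤ r ∧ ∀ t : ℝ≥0, r ≤ t → P x t})
    (fun x => Set.OrdConnected.convex ⟨fun a ha b _ c hc =>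
      ⟨ha.1.trans hc.1, fun t ht => ha.2 t (hc.1.trans ht)⟩⟩)
    (fun x => by
      obtain ⟨U, hU, S, hS, hUS⟩ := eventually_prod_iff.1 (h x)
      obtain ⟨r, hr⟩ := eventually_atTop.1 hS
      exact ⟨r, hU.mono fun y hy => ⟨r.2, fun t ht => hUS hy (hr t (by exact_mod_cast ht))⟩⟩)
  refine ⟨fun x => Real.toNNReal (g x), continuous_real_toNNReal.comp g.continuous,
    fun x t ht => (hg x).2 t ?_⟩
  exact Real.toNNReal_le_iff_le_coe.1 ht

theorem exists_monotone_continuous_ge {α : ℝ≥0 → ℝ≥0} (hα : Continuous α) :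
    ∃ φ : ℝ≥0 → ℝ≥0, Continuous φ ∧ Monotone φ ∧ ∀ t, α t ≤ φ t := by
  have hbdd : ∀ t : ℝ≥0, BddAbove ((fun p : ℝ≥0 => α (p * t)) '' Set.Icc 0 1) := fun t =>
    (isCompact_Icc.image (hα.comp (continuous_mul_const t))).bddAbove
  -- This is the running supremum of `α` over `[0, t]`, rescaled to a fixed compact index set so
  -- that its continuity in `t` is immediate.
  refine ⟨fun t => sSup ((fun p : ℝ≥0 => α (p * t)) '' Set.Icc 0 1), ?_, ?_, ?_⟩
  · exact isCompact_Icc.continuous_sSup (f := fun t p : ℝ≥0 => α (p * t))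
      (hα.comp (continuous_snd.mul continuous_fst))
  · intro s t hst
    refine csSup_le_csSup (hbdd t) ⟨_, Set.mem_image_of_mem _ ⟨le_rfl, zero_le_one⟩⟩ ?_
    rintro _ ⟨p, hp, rfl⟩
    rcases eq_or_ne t 0 with rfl | ht
    · exact ⟨p, hp, by simp [le_antisymm hst (zero_le : 0 ≤ s)]⟩
    · refine ⟨p * (s / t), ⟨zero_le, ?_⟩, ?_⟩
      · exact mul_le_one' hp.2 (div_le_one_of_le₀ hst zero_le)
      · simp only [mul_assoc, div_mul_cancel₀ s ht]
  · intro t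
    exact le_csSup (hbdd t) ⟨1, ⟨zero_le_one, le_rfl⟩, by simp⟩

/-- Pairs `(t, s)` with `t` large and then `s` large, locally uniformly in `t`. -/
def iteratedAtTop : Filter (ℝ≥0 × ℝ≥0) := Filter.bind atTop fun t => 𝓝 t ×ˢ atTop

/-- Pairs `(t, s)` with `t` large and `s ≥ φ t`. -/
def aboveGraph (φ : ℝ≥0 → ℝ≥0) : Filter (ℝ≥0 × ℝ≥0) :=
  comap Prod.fst atTop ⊓ 𝓟 {p | φ p.1 ≤ p.2}

theorem eventually_iteratedAtTop {P : ℝ≥0 × ℝ≥0 → Prop} :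
    (∀ᶠ p in iteratedAtTop, P p) ↔ ∀ᶠ t in atTop, ∀ᶠ p in 𝓝 t ×ˢ atTop, P p :=
  Filter.eventually_bind

theorem tendsto_fst_iteratedAtTop : Tendsto Prod.fst iteratedAtTop (atTop : Filter ℝ≥0) := by
  refine tendsto_atTop.2 fun r => eventually_iteratedAtTop.2 ?_
  filter_upwards [eventually_gt_atTop r] with t ht
  exact (tendsto_fst.eventually (lt_mem_nhds ht)).mono fun p hp => le_of_lt hp

theorem tendsto_aboveGraph {X : Type*} {L : Filter X} {φ : ℝ≥0 → ℝ≥0} {k : X → ℝ≥0 × ℝ≥0}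
    (h1 : Tendsto (fun x => (k x).1) L atTop) (h2 : ∀ x, φ (k x).1 ≤ (k x).2) :
    Tendsto k L (aboveGraph φ) :=
  tendsto_inf.2 ⟨tendsto_comap_iff.2 h1, tendsto_principal.2 (Eventually.of_forall h2)⟩

theorem eventually_aboveGraph_prod {X : Type*} {L : Filter X} {φ : ℝ≥0 → ℝ≥0}
    {P : X × (ℝ≥0 × ℝ≥0) → Prop} (h : ∀ᶠ p in L ×ˢ aboveGraph φ, P p) :
    ∀ᶠ p : X × ℝ≥0 in L ×ˢ atTop, ∀ s ≥ φ p.2, P (p.1, (p.2, s)) := by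
  obtain ⟨U, hU, S, hS, hUS⟩ := eventually_prod_iff.1 h
  rw [aboveGraph, eventually_inf_principal] at hS
  obtain ⟨R, hR, hRS⟩ := mem_comap.1 hS
  refine eventually_prod_iff.2 ⟨U, hU, fun t => t ∈ R, hR, fun {x} hx {t} ht s hs => ?_⟩
  exact hUS hx (@hRS (t, s) ht hs)

theorem exists_aboveGraph_le {K : Filter (ℝ≥0 × ℝ≥0)} [K.IsCountablyGenerated]
    (hK : iteratedAtTop ≤ K) :
    ∃ φ : ℝ≥0 → ℝ≥0, Continuous φ ∧ Monotone φ ∧ aboveGraph φ ≤ K := by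
  obtain ⟨S, hS⟩ := K.exists_antitone_basis
  have hSK : ∀ n, ∃ Q : ℝ≥0, ∀ t ≥ Q, ∀ᶠ p in 𝓝 t ×ˢ atTop, p ∈ S n := fun n =>
    eventually_atTop.1 (eventually_iteratedAtTop.1 (hK (hS.mem n)))
  choose Q hQ using hSK
  obtain ⟨α, hα, hαP⟩ := exists_continuous_threshold
    (P := fun t s => ∀ n : ℕ, (n : ℝ≥0) ≤ t → Q n + 1 ≤ t → (t, s) ∈ S n) (fun t => by
      -- Near `t` only the finitely many `n ≤ N` matter. The margin in `Q n + 1` ensures that a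
      -- constraint active at some `t' < t + 1` already has `Q n ≤ t`, so that `hQ n t` covers it.
      obtain ⟨N, hN⟩ := exists_nat_ge (t + 1)
      have h : ∀ᶠ p in 𝓝 t ×ˢ atTop, ∀ n ∈ Finset.range (N + 1), Q n ≤ t → p ∈ S n := by
        refine (eventually_all_finset _).2 fun n _ => ?_
        by_cases hn : Q n ≤ t
        · exact (hQ n t hn).mono fun p hp _ => hp
        · exact Eventually.of_forall fun p hp => absurd hp hn
      have ht : ∀ᶠ p : ℝ≥0 × ℝ≥0 in 𝓝 t ×ˢ atTop, p.1 < t + 1 :=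
        tendsto_fst.eventually (gt_mem_nhds (lt_add_one t))
      filter_upwards [h, ht] with p hp hpt n hn hQn
      refine hp n (Finset.mem_range.2 ?_) ?_
      · have : (n : ℝ≥0) ≤ N := hn.trans (hpt.le.trans hN)
        exact Nat.lt_succ_of_le (by exact_mod_cast this)
      · exact le_of_lt (lt_of_add_lt_add_right (hQn.trans_lt hpt)))
  obtain ⟨φ, hφ, hmono, hle⟩ := exists_monotone_continuous_ge hα
  refine ⟨φ, hφ, hmono, hS.ge_iff.2 fun n _ => ?_⟩
  rw [aboveGraph, mem_inf_principal]
  refine mem_of_superset (preimage_mem_comap (Ici_mem_atTop (max (n : ℝ≥0) (Q n + 1))))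
    fun p hp hps => ?_
  exact hαP p.1 p.2 ((hle _).trans hps) n ((le_max_left _ _).trans hp)
    ((le_max_right _ _).trans hp)

theorem aboveGraph_mono {φ θ : ℝ≥0 → ℝ≥0} (h : ∀ t, φ t ≤ θ t) : aboveGraph θ ≤ aboveGraph φ :=
  inf_le_inf_left _ (principal_mono.2 fun p hp => (h p.1).trans hp)

/-- A condition on points of a Lindelöf space that holds locally along `L` holds locally along a
countably generated filter. -/
theorem exists_countablyGenerated_of_local {X T ι : Type*} [Countable ι] [TopologicalSpace X]
    [SecondCountableTopology X] {L : Filter T} {Q : ι → Set X → Set T → Prop}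
    (h : ∀ i x, ∃ U ∈ 𝓝 x, ∃ S ∈ L, Q i U S) :
    ∃ K : Filter T, L ≤ K ∧ K.IsCountablyGenerated ∧ ∀ i x, ∃ U ∈ 𝓝 x, ∃ S ∈ K, Q i U S := by
  choose U hU S hS hQ using h
  choose c hc hcov using fun i => TopologicalSpace.countable_cover_nhds
    (f := fun x => interior (U i x)) (fun x => interior_mem_nhds.2 (hU i x))
  -- Only the sets `S i y` at the countably many centres `y` of the subcover are kept as generators.
  refine ⟨generate (⋃ i, S i '' c i), ?_, ⟨_, Set.countable_iUnion fun i => (hc i).image _, rfl⟩,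
    fun i x => ?_⟩
  · refine le_generate_iff.2 (Set.iUnion_subset fun i => ?_)
    rintro _ ⟨x, -, rfl⟩
    exact hS i x
  · have hx : x ∈ ⋃ y ∈ c i, interior (U i y) := hcov i ▸ Set.mem_univ x
    obtain ⟨y, hy, hxy⟩ := Set.mem_iUnion₂.1 hx
    exact ⟨U i y, mem_interior_iff_mem_nhds.1 hxy, S i y,
      mem_generate_of_mem (Set.mem_iUnion.2 ⟨i, Set.mem_image_of_mem _ hy⟩), hQ i y⟩

theorem exists_countablyGenerated_tendsto {X T B : Type*} [TopologicalSpace X]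
    [SecondCountableTopology X] [TopologicalSpace B] {b : B} [(𝓝 b).IsCountablyGenerated]
    {L : Filter T} {Φ : X × T → B} (h : ∀ x, Tendsto Φ (𝓝 x ×ˢ L) (𝓝 b)) :
    ∃ K : Filter T, L ≤ K ∧ K.IsCountablyGenerated ∧ ∀ x, Tendsto Φ (𝓝 x ×ˢ K) (𝓝 b) := by
  obtain ⟨W, hW⟩ := (𝓝 b).exists_antitone_basis
  obtain ⟨K, hLK, hK, hKQ⟩ := exists_countablyGenerated_of_local (ι := ℕ) (L := L)
    (Q := fun n (U : Set X) S => U ×ˢ S ⊆ Φ ⁻¹' W n)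
    fun n x => mem_prod_iff.1 ((h x).eventually_mem (hW.mem n))
  exact ⟨K, hLK, hK, fun x => hW.tendsto_right_iff.2 fun n _ => mem_prod_iff.2 (hKQ n x)⟩

end Thresholds

/-! ### Reduction to a countably generated filter. -/

theorem IsAsymptoticAlong.exists_countablyGenerated {T A B : Type*}
    [NonUnitalRing A] [StarRing A] [Module ℂ A] [MetricSpace A] [SMLCStarAlgebra A]
    [NonUnitalRing B] [StarRing B] [Module ℂ B] [MetricSpace B] [SMLCStarAlgebra B]
    {L : Filter T} {F : T → A → B} (hF : IsAsymptoticAlong L F) :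
    ∃ K : Filter T, L ≤ K ∧ K.IsCountablyGenerated ∧ IsAsymptoticAlong K F := by
  have : SecondCountableTopology A := UniformSpace.secondCountable_of_separable A
  obtain ⟨W, hW⟩ := (𝓝 (0 : B)).exists_antitone_basis
  obtain ⟨K₁, hL₁, _, h₁⟩ := exists_countablyGenerated_of_local (ι := ℕ) (L := L)
    (Q := fun n (U : Set A) S => ∃ V ∈ 𝓝 (0 : ℂ), V ×ˢ (U ×ˢ S) ⊆
      (fun p : ℂ × (A × T) => p.1 • F p.2.2 p.2.1) ⁻¹' W n) fun n a => by
        obtain ⟨V, hV, R, hR, h⟩ := mem_prod_iff.1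
          (Tendsto.eventually_mem (hF.bounded_nhds a) (hW.mem n))
        obtain ⟨U, hU, S, hS, hUS⟩ := mem_prod_iff.1 hR
        exact ⟨U, hU, S, hS, V, hV, (Set.prod_mono_right hUS).trans h⟩
  -- The condition compares two arbitrary points of `U` and so does not mention the centre; it
  -- therefore passes from the countably many centres to every point they cover.
  obtain ⟨K₂, hL₂, _, h₂⟩ := exists_countablyGenerated_of_local (ι := ℕ) (L := L)
    (Q := fun n (U : Set A) S => ∀ a ∈ U, ∀ b ∈ U, ∀ t ∈ S, F t a - F t b ∈ W n) fun n a => by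
        have hsub : Tendsto (fun p : B × B => p.1 - p.2) (𝓝 0 ×ˢ 𝓝 0) (𝓝 0) := by
          simpa [nhds_prod_eq] using (continuous_sub (G := B)).tendsto (0, 0)
        obtain ⟨V, hV, V', hV', hVW⟩ := mem_prod_iff.1 (hsub.eventually_mem (hW.mem n))
        obtain ⟨U, hU, S, hS, hUS⟩ := mem_prod_iff.1
          ((hF.sac a).eventually_mem (inter_mem hV hV'))
        refine ⟨U, hU, S, hS, fun x hx y hy t ht => ?_⟩
        have := @hVW (F t x - F t a, F t y - F t a)
          ⟨(@hUS (x, t) ⟨hx, ht⟩).1, (@hUS (y, t) ⟨hy, ht⟩).2⟩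
        simpa using this
  obtain ⟨K₃, hL₃, _, h₃⟩ := exists_countablyGenerated_tendsto hF.star_nhds
  obtain ⟨K₄, hL₄, _, h₄⟩ := exists_countablyGenerated_tendsto hF.smul_nhds
  obtain ⟨K₅, hL₅, _, h₅⟩ := exists_countablyGenerated_tendsto hF.add_nhds
  obtain ⟨K₆, hL₆, _, h₆⟩ := exists_countablyGenerated_tendsto hF.mul_nhds
  have key : ∀ {X : Type _} [TopologicalSpace X] {K K' : Filter T} {Φ : X × T → B} (x : X),
      K' ≤ K → Tendsto Φ (𝓝 x ×ˢ K) (𝓝 0) → Tendsto (fun t => Φ (x, t)) K' (𝓝 0) :=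
    fun x hle h => h.comp (tendsto_const_nhds.prodMk (tendsto_id.mono_left hle))
  refine ⟨K₁ ⊓ (K₂ ⊓ (K₃ ⊓ (K₄ ⊓ (K₅ ⊓ K₆)))),
    le_inf hL₁ (le_inf hL₂ (le_inf hL₃ (le_inf hL₄ (le_inf hL₅ hL₆)))), inferInstance, ?_⟩
  set K := K₁ ⊓ (K₂ ⊓ (K₃ ⊓ (K₄ ⊓ (K₅ ⊓ K₆)))) with hK
  have e₁ : K ≤ K₁ := inf_le_left
  have e₂ : K ≤ K₂ := inf_le_right.trans inf_le_left
  have f₂ : K ≤ K₃ ⊓ (K₄ ⊓ (K₅ ⊓ K₆)) := inf_le_right.trans inf_le_right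
  have f₃ : K ≤ K₄ ⊓ (K₅ ⊓ K₆) := f₂.trans inf_le_right
  have f₄ : K ≤ K₅ ⊓ K₆ := f₃.trans inf_le_right
  refine ⟨fun a => ?_, fun a => ?_, fun a => ?_, fun c a => ?_, fun a b => ?_, fun a b => ?_⟩
  · refine hW.tendsto_right_iff.2 fun n _ => ?_
    obtain ⟨U, hU, S, hS, V, hV, h⟩ := h₁ n a
    filter_upwards [prod_mem_prod hV (e₁ hS)] with p hp
    exact @h (p.1, (a, p.2)) ⟨hp.1, mem_of_mem_nhds hU, hp.2⟩
  · refine hW.tendsto_right_iff.2 fun n _ => ?_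
    obtain ⟨U, hU, S, hS, h⟩ := h₂ n a
    filter_upwards [prod_mem_prod hU (e₂ hS)] with p hp
    exact h _ hp.1 _ (mem_of_mem_nhds hU) _ hp.2
  · exact key a (f₂.trans inf_le_left) (h₃ a)
  · exact key (c, a) (f₃.trans inf_le_left) (h₄ (c, a))
  · exact key (a, b) (f₄.trans inf_le_left) (h₅ (a, b))
  · exact key (a, b) (f₄.trans inf_le_right) (h₆ (a, b))

/-! ### PBAMs as asymptotic morphisms along `atTop`, and homotopies. -/

section Conversions

theorem SMLCStarAlgebra.dist_sub_zero {B : Type*} [NonUnitalRing B] [StarRing B] [Module ℂ B]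
    [MetricSpace B] [SMLCStarAlgebra B] (x y : B) : dist (x - y) 0 = dist x y := by
  simpa using (SMLCStarAlgebra.dist_add_right_eq (x - y) 0 y).symm

theorem ContinuousMap.dist_sub_zero_of_forall {X B : Type*} [TopologicalSpace X] [CompactSpace X]
    [NonUnitalRing B] [MetricSpace B] [IsTopologicalRing B]
    (hd : ∀ x y : B, dist (x - y) 0 = dist x y) (k l : C(X, B)) :
    dist (k - l) 0 = dist k l := by
  refine le_antisymm ?_ ?_ <;> refine (ContinuousMap.dist_le dist_nonneg).2 fun p => ?_
  · have := ContinuousMap.dist_apply_le_dist (f := k) (g := l) p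
    simpa [hd] using this
  · have := ContinuousMap.dist_apply_le_dist (f := k - l) (g := 0) p
    simpa [hd] using this

/-- The tail is absorbed by hypothesis, the initial segment by compactness. -/
theorem isVonNBounded_range_of_boundedAlong {B : Type*} [NonUnitalRing B] [Module ℂ B]
    [TopologicalSpace B] [IsTopologicalAddGroup B] [ContinuousSMul ℂ B] {u : ℝ≥0 → B}
    (hu : Continuous u) (hb : BoundedAlong atTop u) :
    Bornology.IsVonNBounded ℂ (Set.range u) := by
  intro W hW
  obtain ⟨V, hV, S, hS, hVS⟩ := mem_prod_iff.1 (Tendsto.eventually_mem hb hW)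
  obtain ⟨Q, hQ⟩ := mem_atTop_sets.1 hS
  have h1 : Absorbs ℂ W (u '' Set.Icc 0 Q) :=
    IsCompact.isVonNBounded (𝕜 := ℂ) (isCompact_Icc.image hu) hW
  have h2 : Absorbs ℂ W (u '' Set.Ici Q) := by
    refine (absorbs_iff_eventually_nhds_zero (mem_of_mem_nhds hW)).2 ?_
    filter_upwards [hV] with c hc
    rintro _ ⟨t, ht, rfl⟩
    exact @hVS (c, t) ⟨hc, hQ t ht⟩
  refine (h1.union h2).mono_right ?_
  rintro _ ⟨t, rfl⟩
  rcases le_total t Q with h | h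
  · exact Or.inl ⟨t, ⟨zero_le, h⟩, rfl⟩
  · exact Or.inr ⟨t, h, rfl⟩

section General

variable {A B : Type*} [NonUnitalRing A] [StarRing A] [Module ℂ A] [MetricSpace A]
  [NonUnitalRing B] [StarRing B] [Module ℂ B] [MetricSpace B]

theorem IsPBAM.isAsymptoticAlong_of_dist [ContinuousSMul ℂ B] {f : ℝ≥0 → A → B} (hf : IsPBAM f)
    (hd : ∀ x y : B, dist (x - y) 0 = dist x y) : IsAsymptoticAlong atTop f where
  bounded a := boundedAlong_of_isVonNBounded (hf.bounded a)
  sac a := by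
    refine Metric.tendsto_nhds.2 fun ε hε => ?_
    obtain ⟨η, hη, P, h⟩ := hf.sac ε hε a
    filter_upwards [prod_mem_prod (Metric.ball_mem_nhds a hη) (Ici_mem_atTop P)] with p hp
    rw [hd, dist_comm]
    exact h p.1 (by rw [dist_comm]; exact hp.1) p.2 hp.2
  star := hf.star_tendsto
  smul c a := hf.smul_tendsto a c
  add := hf.add_tendsto
  mul := hf.mul_tendsto

theorem IsAsymptoticAlong.isPBAM_of_dist [IsTopologicalAddGroup B] [ContinuousSMul ℂ B]
    {f : ℝ≥0 → A → B} (hf : IsAsymptoticAlong atTop f)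
    (hd : ∀ x y : B, dist (x - y) 0 = dist x y)
    (hc : Continuous fun x : A × ℝ≥0 => f x.2 x.1) : IsPBAM f where
  continuous := hc
  bounded a := isVonNBounded_range_of_boundedAlong
    (hc.comp (continuous_const.prodMk continuous_id)) (hf.bounded a)
  sac := by
    intro ε hε a
    obtain ⟨U, hU, S, hS, hUS⟩ := mem_prod_iff.1
      ((hf.sac a).eventually_mem (Metric.ball_mem_nhds 0 hε))
    obtain ⟨η, hη, hηU⟩ := Metric.mem_nhds_iff.1 hU
    obtain ⟨P, hP⟩ := mem_atTop_sets.1 hS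
    refine ⟨η, hη, P, fun x hx t ht => ?_⟩
    have h := @hUS (x, t) ⟨hηU (by rw [Metric.mem_ball, dist_comm]; exact hx), hP t ht⟩
    rw [dist_comm, ← hd]
    exact h
  star_tendsto := hf.star
  smul_tendsto a c := hf.smul c a
  add_tendsto := hf.add
  mul_tendsto := hf.mul

end General

theorem eventually_prod_top {X Y : Type*} {L : Filter X} {P : X × Y → Prop} :
    (∀ᶠ p in L ×ˢ (⊤ : Filter Y), P p) ↔ ∀ᶠ x in L, ∀ y, P (x, y) := by
  rw [← Filter.principal_univ, eventually_prod_principal_iff]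
  simp

theorem ContinuousMap.tendsto_zero_iff {X K B : Type*} [TopologicalSpace K] [CompactSpace K]
    [NonUnitalRing B] [MetricSpace B] [IsTopologicalRing B] {L : Filter X} {k : X → C(K, B)} :
    Tendsto k L (𝓝 0) ↔ Tendsto (fun p : X × K => k p.1 p.2) (L ×ˢ ⊤) (𝓝 0) := by
  simp only [Metric.tendsto_nhds, eventually_prod_top]
  refine forall₂_congr fun ε hε => eventually_congr (Eventually.of_forall fun x => ?_)
  exact ContinuousMap.dist_lt_iff hε

theorem tendsto_prod_assoc_iff {X Y Z W : Type*} {f : Filter X} {g : Filter Y} {h : Filter Z}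
    {l : Filter W} {k : X × (Y × Z) → W} :
    Tendsto (fun p : (X × Y) × Z => k (p.1.1, (p.1.2, p.2))) ((f ×ˢ g) ×ˢ h) l ↔
      Tendsto k (f ×ˢ (g ×ˢ h)) l := by
  rw [← Filter.prod_assoc, tendsto_map'_iff]
  rfl

variable {T A B : Type*}
  [NonUnitalRing A] [StarRing A] [Module ℂ A] [MetricSpace A]
  [NonUnitalRing B] [StarRing B] [Module ℂ B] [MetricSpace B] [SMLCStarAlgebra B]

theorem IsPBAM.isAsymptoticAlong {f : ℝ≥0 → A → B} (hf : IsPBAM f) : IsAsymptoticAlong atTop f :=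
  hf.isAsymptoticAlong_of_dist SMLCStarAlgebra.dist_sub_zero

/-- Supremum-metric convergence is convergence along `⊤` in the parameter. A homotopy thus becomes
an asymptotic morphism into `B` itself, and the results on near unitaries apply uniformly in the
parameter. -/
theorem isAsymptoticAlong_path_iff {L : Filter T} {h : T → A → C(I, B)} :
    IsAsymptoticAlong L h ↔ IsAsymptoticAlong (L ×ˢ ⊤) fun (p : T × I) a => h p.1 a p.2 := by
  constructor
  · intro hh
    exact
      { bounded := fun a => tendsto_prod_assoc_iff.1 (ContinuousMap.tendsto_zero_iff.1
          (hh.bounded a))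
        sac := fun a => tendsto_prod_assoc_iff.1 (ContinuousMap.tendsto_zero_iff.1 (hh.sac a))
        star := fun a => ContinuousMap.tendsto_zero_iff.1 (hh.star a)
        smul := fun c a => ContinuousMap.tendsto_zero_iff.1 (hh.smul c a)
        add := fun a b => ContinuousMap.tendsto_zero_iff.1 (hh.add a b)
        mul := fun a b => ContinuousMap.tendsto_zero_iff.1 (hh.mul a b) }
  · intro hh
    exact
      { bounded := fun a => ContinuousMap.tendsto_zero_iff.2 (tendsto_prod_assoc_iff.2
          (hh.bounded a))
        sac := fun a => ContinuousMap.tendsto_zero_iff.2 (tendsto_prod_assoc_iff.2 (hh.sac a))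
        star := fun a => ContinuousMap.tendsto_zero_iff.2 (hh.star a)
        smul := fun c a => ContinuousMap.tendsto_zero_iff.2 (hh.smul c a)
        add := fun a b => ContinuousMap.tendsto_zero_iff.2 (hh.add a b)
        mul := fun a b => ContinuousMap.tendsto_zero_iff.2 (hh.mul a b) }

theorem IsPBAM.isAsymptoticAlong_path {h : ℝ≥0 → A → C(I, B)} (hh : IsPBAM h) :
    IsAsymptoticAlong (atTop ×ˢ ⊤) fun (p : ℝ≥0 × I) a => h p.1 a p.2 :=
  isAsymptoticAlong_path_iff.1 (hh.isAsymptoticAlong_of_dist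
    (ContinuousMap.dist_sub_zero_of_forall SMLCStarAlgebra.dist_sub_zero))

end Conversions

/-! ### Composites and valid reparameterisations. -/

section Composite

variable {A B C : Type*}
  [NonUnitalRing A] [StarRing A] [Module ℂ A] [MetricSpace A] [SMLCStarAlgebra A]
  [NonUnitalRing B] [StarRing B] [Module ℂ B] [MetricSpace B] [SMLCStarAlgebra B]
  [NonUnitalRing C] [StarRing C] [Module ℂ C] [MetricSpace C] [SMLCStarAlgebra C]
  {f : ℝ≥0 → A → B} {g : ℝ≥0 → B → C}

theorem IsPBAM.continuous_index (hf : IsPBAM f) (a : A) : Continuous fun t => f t a :=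
  hf.continuous.comp (continuous_const.prodMk continuous_id)

/-- C1 speaks of one `t` at a time. For `t'` near `t`, both `f t' a` and any `b` close to it are
within `ξ` of `f t a`, so two uses of C1 at `t` compare their images. -/
theorem ConditionC1.eventually_iteratedAtTop (hC1 : ConditionC1 f g) (hf : IsPBAM f) (a : A)
    {ν : ℝ} (hν : 0 < ν) : ∃ ξ > 0, ∀ᶠ p in iteratedAtTop, ∀ b : B,
      dist (f p.1 a) b < ξ → dist (g p.2 (f p.1 a)) (g p.2 b) < ν := by
  obtain ⟨ξ, hξ, Q, hQ⟩ := hC1 a (ν / 2) (half_pos hν)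
  refine ⟨ξ / 2, half_pos hξ, _root_.eventually_iteratedAtTop.2 ?_⟩
  filter_upwards [eventually_ge_atTop Q] with t ht
  obtain ⟨S, hS⟩ := hQ t ht
  have h1 : ∀ᶠ t' in 𝓝 t, dist (f t' a) (f t a) < ξ / 2 :=
    Metric.tendsto_nhds.1 ((hf.continuous_index a).tendsto t) _ (half_pos hξ)
  filter_upwards [h1.prod_mk (eventually_ge_atTop S)] with p hp b hb
  have e1 := hS (f p.1 a) p.2 (by rw [dist_comm]; linarith [hp.1]) hp.2
  have e2 := hS b p.2 (by
    have := dist_triangle_left (f t a) b (f p.1 a)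
    linarith [hp.1]) hp.2
  have := dist_triangle_left (g p.2 (f p.1 a)) (g p.2 b) (g p.2 (f t a))
  linarith

theorem ConditionC1.tendsto_sub (hC1 : ConditionC1 f g) (hf : IsPBAM f) {W : Type*}
    {M : Filter W} {k : W → ℝ≥0 × ℝ≥0} {z : W → B} {a : A} (hk : Tendsto k M iteratedAtTop)
    (hz : Tendsto (fun w => z w - f (k w).1 a) M (𝓝 0)) :
    Tendsto (fun w => g (k w).2 (z w) - g (k w).2 (f (k w).1 a)) M (𝓝 0) := by
  refine Metric.tendsto_nhds.2 fun ν hν => ?_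
  obtain ⟨ξ, hξ, h⟩ := hC1.eventually_iteratedAtTop hf a hν
  filter_upwards [hk.eventually h, Metric.tendsto_nhds.1 hz ξ hξ] with w h1 h2
  rw [SMLCStarAlgebra.dist_sub_zero, dist_comm] at h2 ⊢
  exact h1 _ h2

theorem tendsto_iteratedAtTop_of_nhds {X D : Type*} [TopologicalSpace X] {l : Filter D}
    {Φ : X × ℝ≥0 → D} (hΦ : ∀ x, Tendsto Φ (𝓝 x ×ˢ atTop) l) {z : ℝ≥0 → X} (hz : Continuous z) :
    Tendsto (fun p : ℝ≥0 × ℝ≥0 => Φ (z p.1, p.2)) iteratedAtTop l := by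
  intro W hW
  refine eventually_iteratedAtTop.2 (Eventually.of_forall fun t => ?_)
  exact ((hΦ (z t)).comp ((hz.tendsto t).prodMap tendsto_id)).eventually_mem hW

/-- C3 gives boundedness. Each identity telescopes into the defect of `g` at points `f t a`, which
vanishes as `s → ∞` near each `t`, and the defect of `f` carried through `g` by C1. -/
theorem isAsymptoticAlong_comp (hf : IsPBAM f) (hg : IsPBAM g) (hC1 : ConditionC1 f g)
    (hC3 : ConditionC3 f g) :
    IsAsymptoticAlong iteratedAtTop fun (p : ℝ≥0 × ℝ≥0) a => g p.2 (f p.1 a) := by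
  have hfa := hf.isAsymptoticAlong
  have hga := hg.isAsymptoticAlong
  have hfc := hf.continuous_index
  refine ⟨fun a => ?_, fun a => ?_, fun a => ?_, fun c a => ?_, fun a b => ?_, fun a b => ?_⟩
  · refine boundedAlong_of_seminorm fun q hq => ?_
    obtain ⟨Q, M, hM⟩ := hC3 a q hq
    refine ⟨1 + M, eventually_iteratedAtTop.2 ?_⟩
    filter_upwards [eventually_ge_atTop Q] with t ht
    obtain ⟨S, hS⟩ := hM t ht
    have h1 := hga.sac_comp ((hfc a).tendsto t)
    have h2 : ∀ᶠ p : ℝ≥0 × ℝ≥0 in 𝓝 t ×ˢ atTop, q (g p.2 (f p.1 a) - g p.2 (f t a)) < 1 := by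
      have := (hq.tendsto 0).comp h1
      rw [map_zero] at this
      exact this.eventually (gt_mem_nhds one_pos)
    filter_upwards [h2, tendsto_snd.eventually (eventually_ge_atTop S)] with p hp hpS
    have h3 := map_add_le_add q (g p.2 (f p.1 a) - g p.2 (f t a)) (g p.2 (f t a))
    rw [sub_add_cancel] at h3
    linarith [hS p.2 hpS]
  · refine hC1.tendsto_sub hf (k := Prod.snd) tendsto_snd ?_
    exact (hfa.sac a).comp (tendsto_id.prodMap tendsto_fst_iteratedAtTop)
  · have h1 := tendsto_iteratedAtTop_of_nhds hga.star_nhds (hfc a)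
    have h2 := hC1.tendsto_sub hf tendsto_id ((hfa.star a).comp tendsto_fst_iteratedAtTop)
    have h := h1.add h2
    rw [add_zero] at h
    exact h.congr fun p => sub_add_sub_cancel _ _ _
  · have h1 := tendsto_iteratedAtTop_of_nhds hga.smul_nhds
      (continuous_const.prodMk (hfc a) : Continuous fun t => (c, f t a))
    have h2 := hC1.tendsto_sub hf tendsto_id ((hfa.smul c a).comp tendsto_fst_iteratedAtTop)
    have h := h1.add h2
    rw [add_zero] at h
    exact h.congr fun p => sub_add_sub_cancel _ _ _
  · have h1 := tendsto_iteratedAtTop_of_nhds hga.add_nhds ((hfc a).prodMk (hfc b))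
    have h2 := hC1.tendsto_sub hf tendsto_id ((hfa.add a b).comp tendsto_fst_iteratedAtTop)
    have h := h1.add h2
    rw [add_zero] at h
    exact h.congr fun p => sub_add_sub_cancel _ _ _
  · have h1 := tendsto_iteratedAtTop_of_nhds hga.mul_nhds ((hfc a).prodMk (hfc b))
    have h2 := hC1.tendsto_sub hf tendsto_id ((hfa.mul a b).comp tendsto_fst_iteratedAtTop)
    have h := h1.add h2
    rw [add_zero] at h
    exact h.congr fun p => sub_add_sub_cancel _ _ _

theorem exists_aboveGraph_isAsymptoticAlong (hf : IsPBAM f) (hg : IsPBAM g)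
    (hC1 : ConditionC1 f g) (hC3 : ConditionC3 f g) :
    ∃ φ : ℝ≥0 → ℝ≥0, Continuous φ ∧ Monotone φ ∧
      IsAsymptoticAlong (aboveGraph φ) fun (p : ℝ≥0 × ℝ≥0) a => g p.2 (f p.1 a) := by
  obtain ⟨K, hK, _, hKa⟩ := (isAsymptoticAlong_comp hf hg hC1 hC3).exists_countablyGenerated
  obtain ⟨φ, hφ, hmono, hle⟩ := exists_aboveGraph_le hK
  exact ⟨φ, hφ, hmono, hKa.comp_tendsto (tendsto_id.mono_left hle)⟩

/-- Any index function lying above `φ` tends to `aboveGraph φ`; this covers every `θ ≥ φ` and,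
uniformly in the parameter, the convex combinations of `φ` and `θ`. -/
theorem IsAsymptoticAlong.isValidReparam {φ : ℝ≥0 → ℝ≥0} (hφ : Continuous φ) (hmono : Monotone φ)
    (hf : IsPBAM f) (hg : IsPBAM g)
    (h : IsAsymptoticAlong (aboveGraph φ) fun (p : ℝ≥0 × ℝ≥0) a => g p.2 (f p.1 a)) :
    IsValidReparam f g φ := by
  have hcomp : ∀ θ : ℝ≥0 → ℝ≥0, Continuous θ → (∀ t, φ t ≤ θ t) → IsPBAM (pbamComp g θ f) := by
    intro θ hθ hle
    refine IsAsymptoticAlong.isPBAM_of_dist ?_ SMLCStarAlgebra.dist_sub_zero ?_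
    · exact h.comp_tendsto (k := fun t => (t, θ t)) (tendsto_aboveGraph tendsto_id hle)
    · exact hg.continuous.comp (hf.continuous.prodMk (hθ.comp continuous_snd))
  refine ⟨hφ, hmono, hcomp φ hφ fun _ => le_rfl, fun θ hθ _ hle => ⟨hcomp θ hθ hle, ?_⟩⟩
  set κ : ℝ≥0 × I → ℝ≥0 := fun q => unitInterval.toNNReal q.2 * φ q.1 +
    unitInterval.toNNReal (unitInterval.symm q.2) * θ q.1 with hκ
  have hκc : Continuous κ := by fun_prop
  have hκle : ∀ q, φ q.1 ≤ κ q := fun q => by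
    calc φ q.1 = unitInterval.toNNReal q.2 * φ q.1 +
          unitInterval.toNNReal (unitInterval.symm q.2) * φ q.1 := by
            rw [← add_mul, unitInterval.toNNReal_add_toNNReal_symm, one_mul]
      _ ≤ κ q := by
        simp only [hκ]
        gcongr
        exact hle q.1
  have hc : Continuous fun q : (A × ℝ≥0) × I => g (κ (q.1.2, q.2)) (f q.1.2 q.1.1) :=
    hg.continuous.comp ((hf.continuous.comp continuous_fst).prodMk
      (hκc.comp ((continuous_snd.comp continuous_fst).prodMk continuous_snd)))
  refine ⟨fun t a => ⟨fun p => g (κ (t, p)) (f t a),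
    hc.comp (f := fun p : I => ((a, t), p)) (by fun_prop)⟩, ⟨?_, fun t a => ?_⟩,
    fun t a p => rfl⟩
  · refine IsAsymptoticAlong.isPBAM_of_dist ?_
      (ContinuousMap.dist_sub_zero_of_forall SMLCStarAlgebra.dist_sub_zero) ?_
    · refine isAsymptoticAlong_path_iff.2 ?_
      exact h.comp_tendsto (k := fun q : ℝ≥0 × I => (q.1, κ q))
        (tendsto_aboveGraph tendsto_fst hκle)
    · exact ContinuousMap.continuous_of_continuous_uncurry _ hc
  · simp [hκ, pbamComp]

end Composite

/-! ### Induced homotopy classes. -/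

section InducedClass

theorem HtpyClass.mk_eq_mk {X Y : Type*} [TopologicalSpace X] [TopologicalSpace Y] {F G : C(X, Y)}
    (H : C(X × I, Y)) (h0 : ∀ x, H (x, 0) = F x) (h1 : ∀ x, H (x, 1) = G x) :
    HtpyClass.mk F = HtpyClass.mk G :=
  Quotient.sound ⟨{
    toContinuousMap := H.comp (ContinuousMap.prodSwap (α := I) (β := X))
    map_zero_left := h0
    map_one_left := h1 }⟩

section Corrected

variable {X B : Type*} [TopologicalSpace X] [NonUnitalRing B] [StarRing B] [Module ℂ B]
  [MetricSpace B] [SMLCStarAlgebra B] {D : InvSqrtData B}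

/-- The map to the quasi-unitaries obtained by correcting `k`. -/
def corrected (D : InvSqrtData B) (k : C(X, B)) (hk : ∀ x, k x ∈ nearUnitary D) :
    C(X, quasiUnitary B) :=
  (unitarize D).comp ⟨fun x => ⟨k x, hk x⟩, k.continuous.subtype_mk hk⟩

theorem mk_corrected_eq {k l : C(X, B)} (hk : ∀ x, k x ∈ nearUnitary D)
    (hl : ∀ x, l x ∈ nearUnitary D) {H : X × I → B} (hHc : Continuous H)
    (hH : ∀ q, H q ∈ nearUnitary D) (h0 : ∀ x, H (x, 0) = k x) (h1 : ∀ x, H (x, 1) = l x) :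
    HtpyClass.mk (corrected D k hk) = HtpyClass.mk (corrected D l hl) :=
  HtpyClass.mk_eq_mk (corrected D ⟨H, hHc⟩ hH)
    (fun x => congrArg (unitarize D) (Subtype.ext (h0 x)))
    (fun x => congrArg (unitarize D) (Subtype.ext (h1 x)))

/-- Correcting a family of maps at two admissible indices gives homotopic maps. -/
theorem mk_corrected_eq_of_index {k l : C(X, B)} (hk : ∀ x, k x ∈ nearUnitary D)
    (hl : ∀ x, l x ∈ nearUnitary D) {j : X × ℝ≥0 → B} (hj : Continuous j) {a b : X → ℝ≥0}
    (ha : Continuous a) (hb : Continuous b) (hja : ∀ x, ∀ t ≥ a x, j (x, t) ∈ nearUnitary D)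
    (hjb : ∀ x, ∀ t ≥ b x, j (x, t) ∈ nearUnitary D) (h0 : ∀ x, j (x, a x) = k x)
    (h1 : ∀ x, j (x, b x) = l x) :
    HtpyClass.mk (corrected D k hk) = HtpyClass.mk (corrected D l hl) := by
  refine mk_corrected_eq hk hl (H := fun q => j (q.1,
    unitInterval.toNNReal (unitInterval.symm q.2) * a q.1 + unitInterval.toNNReal q.2 * b q.1))
    (by fun_prop) (fun q => ?_) (fun x => by simp [h0]) (fun x => by simp [h1])
  have hsum := unitInterval.toNNReal_symm_add_toNNReal q.2
  set r := unitInterval.toNNReal (unitInterval.symm q.2)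
  set p := unitInterval.toNNReal q.2
  -- The interpolated index is at least the smaller of the two, and either bound alone guarantees
  -- correctability.
  rcases le_total (a q.1) (b q.1) with h | h
  · refine hja _ _ ?_
    calc a q.1 = r * a q.1 + p * a q.1 := by rw [← add_mul, hsum, one_mul]
      _ ≤ r * a q.1 + p * b q.1 := by gcongr
  · refine hjb _ _ ?_
    calc b q.1 = r * b q.1 + p * b q.1 := by rw [← add_mul, hsum, one_mul]
      _ ≤ r * a q.1 + p * b q.1 := by gcongr

end Corrected

variable {A B C : Type*}
  [NonUnitalRing A] [StarRing A] [Module ℂ A] [MetricSpace A] [SMLCStarAlgebra A]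
  [NonUnitalRing B] [StarRing B] [Module ℂ B] [MetricSpace B] [SMLCStarAlgebra B]
  [NonUnitalRing C] [StarRing C] [Module ℂ C] [MetricSpace C] [SMLCStarAlgebra C]

theorem IsInducedClass.mk_corrected {D : InvSqrtData B} {f : ℝ≥0 → A → B}
    {c : HtpyClass (quasiUnitary A) (quasiUnitary B)} (hc : IsInducedClass D f c)
    {α : quasiUnitary A → ℝ≥0} (hα : IsAdmissible D f α) {k : C(quasiUnitary A, B)}
    (hk : ∀ v, k v ∈ nearUnitary D) (hkf : ∀ v, k v = f (α v) v) :
    HtpyClass.mk (corrected D k hk) = c := by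
  obtain ⟨F, hF, rfl⟩ := hc.2 α hα
  refine congrArg HtpyClass.mk (ContinuousMap.ext fun v => Subtype.ext ?_)
  rw [hF v, ← hkf v]
  rfl

theorem IsPBAM.continuous_diag {f : ℝ≥0 → A → B} (hf : IsPBAM f) {α : quasiUnitary A → ℝ≥0}
    (hα : Continuous α) : Continuous fun v : quasiUnitary A => f (α v) v :=
  hf.continuous.comp (continuous_subtype_val.prodMk hα)

theorem IsPBAM.exists_isInducedClass {f : ℝ≥0 → A → B} (hf : IsPBAM f) (D : InvSqrtData B) :
    ∃ c, IsInducedClass D f c := by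
  obtain ⟨α₀, hα₀, h₀⟩ := exists_continuous_threshold (X := quasiUnitary A)
    (P := fun v t => f t v ∈ nearUnitary D)
    (hf.isAsymptoticAlong.eventually_mem_nearUnitary D)
  refine ⟨HtpyClass.mk (corrected D ⟨_, hf.continuous_diag hα₀⟩ fun v => h₀ v _ le_rfl),
    ⟨α₀, hα₀, h₀⟩, fun α hα => ?_⟩
  refine ⟨corrected D ⟨_, hf.continuous_diag hα.1⟩ fun v => hα.2 v _ le_rfl, fun v => rfl, ?_⟩
  exact mk_corrected_eq_of_index _ _ (j := fun q => f q.2 q.1)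
    (hf.continuous.comp (continuous_subtype_val.prodMap continuous_id)) hα.1 hα₀ hα.2 h₀
    (fun _ => rfl) (fun _ => rfl)

/-- One threshold serves all parameters in `I`, so correcting the homotopy along it joins
representatives of the two classes. -/
theorem IsPBAHomotopy.isInducedClass {h : ℝ≥0 → A → C(I, B)} {f g : ℝ≥0 → A → B}
    (hh : IsPBAHomotopy h f g) (hf : IsPBAM f) (hg : IsPBAM g) {D : InvSqrtData B}
    {c : HtpyClass (quasiUnitary A) (quasiUnitary B)} (hc : IsInducedClass D f c) :
    IsInducedClass D g c := by
  obtain ⟨c', hc'⟩ := hg.exists_isInducedClass D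
  obtain ⟨α, hα, hnear⟩ := exists_continuous_threshold (X := quasiUnitary A)
    (P := fun v t => ∀ p : I, h t v p ∈ nearUnitary D) (fun v => by
      have := hh.1.isAsymptoticAlong_path.eventually_mem_nearUnitary D v
      rw [← Filter.prod_assoc, eventually_map] at this
      exact eventually_prod_top.1 this)
  have hαf : IsAdmissible D f α := ⟨hα, fun v t ht => (hh.2 t v).1 ▸ hnear v t ht 0⟩
  have hαg : IsAdmissible D g α := ⟨hα, fun v t ht => (hh.2 t v).2 ▸ hnear v t ht 1⟩
  have e := hc.mk_corrected hαf (k := ⟨_, hf.continuous_diag hα⟩)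
    (fun v => hαf.2 v _ le_rfl) fun _ => rfl
  have e' := hc'.mk_corrected hαg (k := ⟨_, hg.continuous_diag hα⟩)
    (fun v => hαg.2 v _ le_rfl) fun _ => rfl
  have hcont : Continuous fun v : quasiUnitary A => h (α v) v :=
    hh.1.continuous.comp (continuous_subtype_val.prodMk hα)
  have hcc : c = c' := by
    rw [← e, ← e']
    exact mk_corrected_eq _ _ (H := fun q => h (α q.1) q.1 q.2)
      (ContinuousEval.continuous_eval.comp ((hcont.comp continuous_fst).prodMk continuous_snd))
      (fun q => hnear q.1 _ le_rfl q.2) (fun v => (hh.2 _ _).1) (fun v => (hh.2 _ _).2)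
  exact hcc ▸ hc'

theorem invSqrtPath_zero (D : InvSqrtData B) (x : B) : invSqrtPath D 0 x = x := by
  simp [invSqrtPath, D.ϑ_zero]

theorem invSqrtPath_one (D : InvSqrtData B) (x : B) :
    invSqrtPath D 1 x = x ⊙ D.ϑ (star x ⊙ x) := by
  simp [invSqrtPath]

theorem continuous_invSqrtPath {X : Type*} [TopologicalSpace X] (D : InvSqrtData B) {k : X → B}
    (hk : Continuous k) (hn : ∀ x, k x ∈ nearUnitary D) :
    Continuous fun q : X × I => invSqrtPath D q.2 (k q.1) := by
  have hk' : Continuous fun q : X × I => k q.1 := hk.comp continuous_fst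
  have hreal : Continuous fun q : X × I => ((q.2 : ℝ) : ℂ) := by fun_prop
  have hy : Continuous fun q : X × I => (q.2 : ℝ) • (star (k q.1) ⊙ k q.1) :=
    (hreal.smul (hk'.star.qmul hk')).congr fun q => Complex.coe_smul _ _
  exact hk'.qmul (D.ϑ_continuousOn.comp_continuous hy fun q =>
    D.V_convex.smul_mem_of_zero_mem D.zero_mem (hn q.1).2 q.2.2)

theorem isInducedClass_comp {f : ℝ≥0 → A → B} {g : ℝ≥0 → B → C} (hf : IsPBAM f) (hg : IsPBAM g)
    {θ : ℝ≥0 → ℝ≥0} (hθ : Continuous θ) (hgf : IsPBAM (pbamComp g θ f))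
    (h : IsAsymptoticAlong (aboveGraph θ) fun (p : ℝ≥0 × ℝ≥0) a => g p.2 (f p.1 a))
    {DB : InvSqrtData B} {DC : InvSqrtData C}
    {u : HtpyClass (quasiUnitary A) (quasiUnitary B)} (hu : IsInducedClass DB f u)
    {v : HtpyClass (quasiUnitary B) (quasiUnitary C)} (hv : IsInducedClass DC g v) :
    IsInducedClass DC (pbamComp g θ f) (v.comp u) := by
  obtain ⟨c, hc⟩ := hgf.exists_isInducedClass DC
  obtain ⟨O, hO, h0, hOn⟩ :=
    hg.isAsymptoticAlong.exists_isOpen_eventually_mem_nearUnitary DC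
  -- `β` must live on the almost unitaries, since the path from `f (γ v) v` to its correction leaves
  -- the quasi-unitaries.
  obtain ⟨β, hβ, hβn⟩ := exists_continuous_threshold (X := almostUnitary O)
    (P := fun w s => g s w ∈ nearUnitary DC) fun w =>
      ((continuous_subtype_val.tendsto w).prodMap tendsto_id).eventually (hOn w w.2)
  obtain ⟨γ, hγ, hγn⟩ := exists_continuous_threshold (X := quasiUnitary A)
    (P := fun v t => f t v ∈ nearUnitary DB ∧
      (∀ r : I, invSqrtPath DB r (f t v) ∈ almostUnitary O) ∧
      ∀ s ≥ θ t, g s (f t v) ∈ nearUnitary DC) fun v => by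
        filter_upwards [hf.isAsymptoticAlong.eventually_mem_nearUnitary DB v,
          hf.isAsymptoticAlong.eventually_invSqrtPath_mem DB hO h0 v,
          eventually_aboveGraph_prod (h.eventually_mem_nearUnitary DC v)] with p h1 h2 h3
        exact ⟨h1, h2, h3⟩
  have hx : Continuous fun v : quasiUnitary A => f (γ v) v := hf.continuous_diag hγ
  have hxn : ∀ v : quasiUnitary A, f (γ v) v ∈ nearUnitary DB := fun v => (hγn v _ le_rfl).1
  have hpath : ∀ (v : quasiUnitary A) r, invSqrtPath DB r (f (γ v) v) ∈ almostUnitary O :=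
    fun v => (hγn v _ le_rfl).2.1
  have hxO : ∀ v : quasiUnitary A, f (γ v) v ∈ almostUnitary O := fun v => by
    simpa only [invSqrtPath_zero] using hpath v 0
  have hgθ : ∀ v : quasiUnitary A, ∀ s ≥ θ (γ v), g s (f (γ v) v) ∈ nearUnitary DC :=
    fun v => (hγn v _ le_rfl).2.2
  obtain ⟨F, hF, rfl⟩ := hu.2 γ ⟨hγ, fun v t ht => (hγn v t ht).1⟩
  obtain ⟨G, hG, rfl⟩ := hv.2
    (fun w => β ⟨w, quasiUnitary_subset_almostUnitary h0 w.2⟩)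
    ⟨hβ.comp (continuous_subtype_val.subtype_mk _), fun w t ht => hβn _ t ht⟩
  -- the map `w ↦ g_{β(w)}(w)` along the path from `f_{γ(v)}(v)` to its correction
  have hK : Continuous fun q : quasiUnitary A × I =>
      (⟨invSqrtPath DB q.2 (f (γ q.1) q.1), hpath q.1 q.2⟩ : almostUnitary O) :=
    (continuous_invSqrtPath DB hx hxn).subtype_mk _
  have hgβ : Continuous fun w : almostUnitary O => g (β w) w :=
    hg.continuous.comp (continuous_subtype_val.prodMk hβ)
  have hk₀ : Continuous fun v : quasiUnitary A => g (β ⟨_, hxO v⟩) (f (γ v) v) :=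
    hgβ.comp (hx.subtype_mk hxO)
  have hFO : ∀ v, (F v : B) ∈ almostUnitary O := fun v =>
    quasiUnitary_subset_almostUnitary h0 (F v).2
  have hk₁ : Continuous fun v : quasiUnitary A => g (β ⟨_, hFO v⟩) (F v) :=
    hgβ.comp ((continuous_subtype_val.comp F.continuous).subtype_mk hFO)
  have e₁ : HtpyClass.mk (corrected DC ⟨_, hk₀⟩ fun v => hβn ⟨_, hxO v⟩ _ le_rfl) =
      HtpyClass.mk (corrected DC ⟨_, hk₁⟩ fun v => hβn ⟨_, hFO v⟩ _ le_rfl) := by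
    refine mk_corrected_eq _ _ (hgβ.comp hK) (fun q => hβn _ _ le_rfl) (fun v => ?_) fun v => ?_
    · simp only [Function.comp_apply, invSqrtPath_zero, ContinuousMap.coe_mk]
    · simp only [Function.comp_apply, invSqrtPath_one, ContinuousMap.coe_mk, hF]
  have hk₂ : Continuous fun v : quasiUnitary A => pbamComp g θ f (γ v) v :=
    hgf.continuous_diag hγ
  -- The point `f (γ v) v` stays fixed while the index of `g` moves from `β` to `θ (γ v)`; no
  -- comparison of these two indices is needed.
  have e₂ : HtpyClass.mk (corrected DC ⟨_, hk₀⟩ fun v => hβn ⟨_, hxO v⟩ _ le_rfl) =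
      HtpyClass.mk (corrected DC ⟨_, hk₂⟩ fun v => hgθ v _ le_rfl) :=
    mk_corrected_eq_of_index _ _ (j := fun q => g q.2 (f (γ q.1) q.1))
      (hg.continuous.comp ((hx.comp continuous_fst).prodMk continuous_snd))
      (hβ.comp (hx.subtype_mk hxO)) (hθ.comp hγ) (fun v t ht => hβn ⟨_, hxO v⟩ t ht) hgθ
      (fun _ => rfl) (fun _ => rfl)
  have e₃ := hc.mk_corrected (α := γ)
    ⟨hγ, fun v t ht => (hγn v t ht).2.2 _ le_rfl⟩ (k := ⟨_, hk₂⟩)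
    (fun v => hgθ v _ le_rfl) fun _ => rfl
  have e₄ : corrected DC ⟨_, hk₁⟩ (fun v => hβn ⟨_, hFO v⟩ _ le_rfl) = G.comp F :=
    ContinuousMap.ext fun v => Subtype.ext (hG (F v)).symm
  have e : c = (HtpyClass.mk G).comp (HtpyClass.mk F) := by
    rw [← e₃, ← e₂, e₁, e₄]
    rfl
  exact e ▸ hc

end InducedClass

theorem mainTheorem4 {A B C : Type*}
    [NonUnitalRing A] [StarRing A] [Module ℂ A] [MetricSpace A] [SMLCStarAlgebra A]
    [NonUnitalRing B] [StarRing B] [Module ℂ B] [MetricSpace B] [SMLCStarAlgebra B]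
    [NonUnitalRing C] [StarRing C] [Module ℂ C] [MetricSpace C] [SMLCStarAlgebra C]
    (DB : InvSqrtData B) (DC : InvSqrtData C)
    (f : ℝ≥0 → A → B) (g : ℝ≥0 → B → C) (hf : IsPBAM f) (hg : IsPBAM g)
    (hC1 : ConditionC1 f g) (hC3 : ConditionC3 f g) :
    (∃ φ : ℝ≥0 → ℝ≥0, IsValidReparam f g φ) ∧
    ∃ (u : HtpyClass (quasiUnitary A) (quasiUnitary B))
      (v : HtpyClass (quasiUnitary B) (quasiUnitary C)),
      IsInducedClass DB f u ∧ IsInducedClass DC g v ∧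
      ∀ φ : ℝ≥0 → ℝ≥0, IsValidReparam f g φ →
        IsInducedClass DC (pbamComp g φ f) (v.comp u) := by
  obtain ⟨ψ, hψ, hψm, hψa⟩ := exists_aboveGraph_isAsymptoticAlong hf hg hC1 hC3
  obtain ⟨u, hu⟩ := hf.exists_isInducedClass DB
  obtain ⟨v, hv⟩ := hg.exists_isInducedClass DC
  refine ⟨⟨ψ, hψa.isValidReparam hψ hψm hf hg⟩, u, v, hu, hv, fun φ hφ => ?_⟩
  -- Asymptotics along the whole region above the graph are known for `ψ`, not for `φ`. The maximum
  -- inherits them from `ψ`, and validity of `φ` supplies a PBA homotopy back to `φ`.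
  have hθ : Continuous fun t => max (φ t) (ψ t) := hφ.continuous.max hψ
  obtain ⟨hgf, h, hh, -⟩ := hφ.homotopic _ hθ (hφ.monotone.max hψm) fun t => le_max_left _ _
  refine hh.isInducedClass hgf hφ.isPBAM (isInducedClass_comp hf hg hθ hgf ?_ hu hv)
  exact hψa.comp_tendsto (tendsto_id.mono_left (aboveGraph_mono fun t => le_max_right _ _))
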